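/- Let $g\ge 0$ be an integer and $1\le r\le\infty$. Let $M$ be a smooth solid handlebody with $g$ handles (orientable or not): a smooth Hausdorff 3-manifold with boundary which is, topologically, the union of a closed 3-cell $B$ and $g$ pairwise disjoint solid cylinders ("handles") $H_1,\dots,H_g\cong D^2\times[-1,1]$, each $H_i$ meeting $B$ exactly in its two end discs $D^2\times\{-1,1\}$, which lie in the sphere $\partial B$; thus $\partial M$ consists of $\partial B$ with the $2g$ open end discs removed, together with the $g$ lateral surfaces $S^1\times[-1,1]$ of the handles. Let $S$ be the closed surface of genus $g$ bounding $M$, i.e. a smooth 2-manifold with a smooth embedding $\iota:S\to M$ such that $\iota(S)=\partial M$. Let $c$ be the centre of $B$ (the image of the origin under the given parametrization of $B$ by the closed unit ball). Then every dynamical system (vector field) $v$ of class $C^r$ on $S$ extends to a dynamical system $V$ of class $C^r$ on all of $M$, i.e. $V(\iota(s))=d\iota_s(v(s))$ for all $s\in S$, in such a way that the only new equilibria are one at the centre $c$ and one in the interior of each handle: there are points $p_i$ in the interiors $\mathring D^2\times(-1,1)$ of the handles $H_i$ ($1\le i\le g$) such that $c,p_1,\dots,p_g$ are interior points of $M$ and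 $$\{x\in M: V(x)=0\}=\iota\big(\{s\in S: v(s)=0\}\big)\cup\{c,p_1,\dots,p_g\}.$$ -/

import Mathlib

open scoped Manifold ContDiff
open Set Metric

/-- The solid cylinder `D² × [-1, 1]`, the model of a handle. -/
def solidCylinder : Set (EuclideanSpace ℝ (Fin 2) × ℝ) :=
  closedBall 0 1 ×ˢ Icc (-1) 1

/-- The two end discs `D² × {-1, 1}` of the solid cylinder. -/
def endDiscs : Set (EuclideanSpace ℝ (Fin 2) × ℝ) :=
  closedBall 0 1 ×ˢ {-1, 1}

/-- The interiors of the two end discs of the solid cylinder. -/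
def openEndDiscs : Set (EuclideanSpace ℝ (Fin 2) × ℝ) :=
  ball 0 1 ×ˢ {-1, 1}

/-- The lateral surface `S¹ × [-1, 1]` of the solid cylinder. -/
def lateralSurface : Set (EuclideanSpace ℝ (Fin 2) × ℝ) :=
  sphere 0 1 ×ˢ Icc (-1) 1

/-- The open solid cylinder, the model of the interior of a handle. -/
def openSolidCylinder : Set (EuclideanSpace ℝ (Fin 2) × ℝ) :=
  ball 0 1 ×ˢ Ioo (-1) 1

/-- A presentation of the 3-manifold with boundary `M` as a solid handlebody with `g` handles
(a "cube with `g` handles"): `M` is a closed 3-cell together with `g` pairwise disjoint solid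
cylinders, each glued to the boundary sphere of the 3-cell exactly along its two end discs. The
handles may be attached in an orientation preserving or in an orientation reversing way.

The maps are only relevant on the closed unit ball and on the solid cylinder. For Hausdorff `M`
they are homeomorphisms from there onto their images, by compactness. -/
structure SolidHandlebody (g : ℕ) (M : Type*) [TopologicalSpace M]
    [ChartedSpace (EuclideanHalfSpace 3) M] where
  /-- the parametrization of the 3-cell -/
  cell : EuclideanSpace ℝ (Fin 3) → M
  /-- the parametrizations of the handles -/
  handle : Fin g → EuclideanSpace ℝ (Fin 2) × ℝ → M
  continuousOn_cell : ContinuousOn cell (closedBall 0 1)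
  injOn_cell : InjOn cell (closedBall 0 1)
  continuousOn_handle : ∀ i, ContinuousOn (handle i) solidCylinder
  injOn_handle : ∀ i, InjOn (handle i) solidCylinder
  /-- the 3-cell and the handles fill `M` -/
  cover : cell '' closedBall 0 1 ∪ ⋃ i, handle i '' solidCylinder = univ
  /-- different handles are disjoint -/
  disjoint_handles :
    Pairwise fun i j ↦ Disjoint (handle i '' solidCylinder) (handle j '' solidCylinder)
  /-- a handle meets the 3-cell exactly in its two end discs … -/
  handle_inter_cell : ∀ i,
    handle i '' solidCylinder ∩ cell '' closedBall 0 1 = handle i '' endDiscs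
  /-- … and these lie on the boundary sphere of the 3-cell -/
  endDiscs_subset : ∀ i, handle i '' endDiscs ⊆ cell '' sphere 0 1
  /-- The surface bounding `M` is the boundary sphere of the 3-cell with the `2g` open end discs
  removed, together with the `g` tubes formed by the lateral surfaces of the handles. -/
  boundary_eq : (𝓡∂ 3).boundary M =
    (cell '' sphere 0 1 \ ⋃ i, handle i '' openEndDiscs) ∪ ⋃ i, handle i '' lateralSurface

namespace SolidHandlebody

variable {g : ℕ} {M : Type*} [TopologicalSpace M] [ChartedSpace (EuclideanHalfSpace 3) M]

/-- The centre of the handlebody: the centre of its 3-cell. -/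
def centre (D : SolidHandlebody g M) : M := D.cell 0

/-- The interior of the `i`-th handle. -/
def handleInterior (D : SolidHandlebody g M) (i : Fin g) : Set M :=
  D.handle i '' openSolidCylinder

end SolidHandlebody

/-- `v` is a vector field of class `C^r` on the smooth manifold `M` (with or without boundary). -/
def IsVectorField {E H : Type*} [NormedAddCommGroup E] [NormedSpace ℝ E] [TopologicalSpace H]
    (I : ModelWithCorners ℝ E H) (r : ℕ∞) {M : Type*} [TopologicalSpace M] [ChartedSpace H M]
    [IsManifold I ∞ M] (v : ∀ x : M, TangentSpace I x) : Prop :=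
  haveI : IsManifold I 1 M := IsManifold.of_le (n := ∞) (by norm_num)
  ContMDiff I I.tangent r (fun x ↦ (⟨x, v x⟩ : TangentBundle I M))

/-! The core is topological: `exists_covectorField` produces a continuous covector field `Λ` on `M`
that vanishes at most at the centre and is a positive multiple of the conormal on the boundary. Any
vector field with `Λ(V) > 0` at a point is nonzero there, and this condition is convex in `V`. So
`V` may be required to equal `dι(v)` on the boundary, to vanish on the finite set `F` formed by the
centre and one point in each handle, and to satisfy `Λ(V) > 0` elsewhere. These fibrewise conditions
are convex, hence `C^r` local solutions glue by a partition of unity. The zeros in the handles are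
simply imposed.

To build `Λ`, the conormal is extended from the boundary. A handle meets the boundary in an annulus
`S¹ × [-1, 1]`, and nonvanishing maps on it extend over `D² × [-1, 1]` because loops in a punctured
space of dimension at least three contract. Afterwards the whole sphere of the 3-cell carries a
nonvanishing section, and coning it off costs one zero, at the centre.

The cotangent bundle enters as the ranges of a continuous family of idempotents on a fixed vector
space. Over a cell or a handle, which is compact and convex in its parametrization, such a family is
conjugate to a constant one, so that sections become vector-valued functions
(`exists_extension_idempotent`). The parametrizations are merely continuous, so `Λ` is in general
only continuous; it is arranged to be smooth near the boundary, where local solutions are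
constructed by division. -/

/-! ### Trivializing families of idempotents, and extending nonvanishing maps -/

/-- A continuous family of idempotents over a compact convex set is conjugate to a constant one. -/
theorem exists_isUnit_conj_idempotent {A V : Type*} [NormedRing A] [CompleteSpace A]
    [NormedAddCommGroup V] [NormedSpace ℝ V] {K : Set V} (hK : IsCompact K) (hc : Convex ℝ K)
    {x₀ : V} (hx₀ : x₀ ∈ K) {q : V → A} (hq : ContinuousOn q K)
    (idem : ∀ x ∈ K, q x * q x = q x) :
    ∃ u : V → A, ContinuousOn u K ∧ ∀ x ∈ K, IsUnit (u x) ∧ u x * q x₀ = q x * u x := by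
  obtain ⟨C, hC⟩ := hK.exists_bound_of_continuousOn hq
  have hC0 : 0 ≤ C := (norm_nonneg _).trans (hC x₀ hx₀)
  obtain ⟨δ, δ0, hδ⟩ := Metric.uniformContinuousOn_iff.1
    (hK.uniformContinuousOn_of_continuous hq) (1 / (2 * C + 1)) (by positivity)
  obtain ⟨R, hR⟩ := hK.exists_bound_of_continuousOn (f := fun x ↦ x - x₀) (by fun_prop)
  have hR0 : 0 ≤ R := (norm_nonneg _).trans (hR x₀ hx₀)
  obtain ⟨n, hn⟩ := exists_nat_gt (R / δ)
  have hn0 : (0 : ℝ) < n := lt_of_le_of_lt (by positivity) hn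
  let p (k : ℕ) (x : V) : V := AffineMap.lineMap x₀ x ((k : ℝ) / n)
  have hp (k : ℕ) (hk : k ≤ n) (x : V) (hx : x ∈ K) : p k x ∈ K := by
    refine hc.lineMap_mem hx₀ hx ⟨by positivity, ?_⟩
    rw [div_le_one hn0]
    exact_mod_cast hk
  have hpc (k : ℕ) : Continuous (p k) := by
    simp only [p, AffineMap.lineMap_apply_module]
    fun_prop
  -- The element `u = q y * q x + (1 - q y) * (1 - q x)` satisfies `u * q x = q y * q x = q y * u`.
  -- It differs from `1` by at most `2C / (2C + 1) < 1` when `x` and `y` are `δ`-close.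
  have hu (x y : V) (hx : x ∈ K) (hy : y ∈ K) (hxy : dist x y < δ) :
      IsUnit (q y * q x + (1 - q y) * (1 - q x)) := by
    have e : q y * q x + (1 - q y) * (1 - q x) =
        1 - ((q x - q y) * q x + q y * (q y - q x)) := by
      simp only [sub_mul, mul_sub, idem x hx, idem y hy, one_mul, mul_one]
      abel
    rw [e]
    refine isUnit_one_sub_of_norm_lt_one ?_
    have h1 := hδ x hx y hy hxy
    rw [dist_eq_norm] at h1
    calc _ ≤ ‖q x - q y‖ * ‖q x‖ + ‖q y‖ * ‖q x - q y‖ := by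
          refine (norm_add_le _ _).trans (add_le_add (norm_mul_le _ _) ?_)
          rw [norm_sub_rev (q x)]
          exact norm_mul_le _ _
      _ ≤ 1 / (2 * C + 1) * C + C * (1 / (2 * C + 1)) := by
          gcongr
          exacts [hC x hx, hC y hy]
      _ < 1 := by
          field_simp
          linarith
  -- The segment from `x₀` to `x` is cut into `n` steps of length at most `R / n < δ`, and the
  -- conjugators of the steps are multiplied.
  have key (k : ℕ) (hk : k ≤ n) : ∃ u : V → A, ContinuousOn u K ∧
      ∀ x ∈ K, IsUnit (u x) ∧ u x * q x₀ = q (p k x) * u x := by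
    induction k with
    | zero => exact ⟨fun _ ↦ 1, continuousOn_const, fun x _ ↦ by simp [p]⟩
    | succ k ih =>
      obtain ⟨u, uc, hu'⟩ := ih (by omega)
      have m1 := hp k (by omega)
      have m2 := hp (k + 1) hk
      have c1 : ContinuousOn (fun x ↦ q (p k x)) K := hq.comp (hpc k).continuousOn m1
      have c2 : ContinuousOn (fun x ↦ q (p (k + 1) x)) K := hq.comp (hpc _).continuousOn m2
      refine ⟨fun x ↦ (q (p (k + 1) x) * q (p k x) + (1 - q (p (k + 1) x)) * (1 - q (p k x))) * u x,
        ((c2.mul c1).add ((continuousOn_const.sub c2).mul (continuousOn_const.sub c1))).mul uc,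
        fun x hx ↦ ⟨(hu _ _ (m1 x hx) (m2 x hx) ?_).mul (hu' x hx).1, ?_⟩⟩
      · rw [dist_lineMap_lineMap, dist_eq_norm, Real.norm_eq_abs]
        have : ((k : ℝ) / n - ((k + 1 : ℕ) : ℝ) / n) = - (1 / n) := by push_cast; field_simp; ring
        rw [this, abs_neg, abs_of_pos (by positivity), dist_comm, dist_eq_norm]
        have := hR x hx
        rw [div_lt_iff₀ δ0] at hn
        calc _ ≤ 1 / n * R := by gcongr
          _ < δ := by rw [one_div, inv_mul_lt_iff₀ hn0]; linarith
      · rw [mul_assoc, (hu' x hx).2]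
        have i1 := idem _ (m1 x hx)
        have i2 := idem _ (m2 x hx)
        simp only [← mul_assoc]
        congr 1
        simp only [add_mul, sub_mul, mul_sub, mul_add, mul_one, one_mul, mul_assoc, i1]
        simp only [← mul_assoc, i2]
        abel
  obtain ⟨u, uc, hu'⟩ := key n le_rfl
  refine ⟨u, uc, fun x hx ↦ ?_⟩
  simpa [p, hn0.ne'] using hu' x hx

/-- Loops in a punctured vector space of dimension at least three are null-homotopic. -/
theorem nullhomotopic_circle {W : Type*} [NormedAddCommGroup W] [NormedSpace ℝ W]
    [FiniteDimensional ℝ W] (hW : 2 < Module.finrank ℝ W)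
    (φ : C(sphere (0 : EuclideanSpace ℝ (Fin 2)) 1, {w : W // w ≠ 0})) : φ.Nullhomotopic := by
  have : TietzeExtension W := TietzeExtension.of_tvs ℝ
  -- Extending over the whole plane allows approximation by a `C¹` map there; an error below `ε`,
  -- the minimum of `‖φ‖`, keeps the straight homotopy from `φ` away from zero.
  obtain ⟨Γ, hΓ⟩ := ContinuousMap.exists_restrict_eq
    (isClosed_sphere (x := (0 : EuclideanSpace ℝ (Fin 2))) (ε := 1))
    ((⟨Subtype.val, continuous_subtype_val⟩ : C({w : W // w ≠ 0}, W)).comp φ)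
  have hΓ' (y : sphere (0 : EuclideanSpace ℝ (Fin 2)) 1) : Γ y = φ y := congr($hΓ y)
  obtain ⟨ε, ε0, hε⟩ : ∃ ε > 0, ∀ y, ε ≤ ‖(φ y : W)‖ := by
    obtain ⟨y, -, hy⟩ := isCompact_univ.exists_isMinOn (f := fun y ↦ ‖(φ y : W)‖)
      (s := (univ : Set (sphere (0 : EuclideanSpace ℝ (Fin 2)) 1)))
      ⟨⟨EuclideanSpace.single 0 1, by simp⟩, mem_univ _⟩ (by fun_prop)
    exact ⟨_, norm_pos_iff.2 (φ y).2, fun z ↦ hy (mem_univ z)⟩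
  obtain ⟨g, gd, hg, -⟩ := Γ.continuous.exists_contDiff_approx 1
    (continuous_const (y := ε)) fun _ ↦ ε0
  let cone : ℝ × ℝ → W := fun p ↦ p.1 • g (!₂[Real.cos p.2, Real.sin p.2])
  have hcone : ContDiff ℝ 1 cone := by
    refine contDiff_fst.smul (gd.comp ?_)
    rw [contDiff_euclidean]
    intro i
    fin_cases i
    · exact Real.contDiff_cos.comp contDiff_snd
    · exact Real.contDiff_sin.comp contDiff_snd
  obtain ⟨u, hu⟩ := (hcone.dense_compl_range_of_finrank_lt_finrank (by simpa using hW)).nonempty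
  have hu0 : u ≠ 0 := fun h ↦ hu ⟨0, by simp [cone, h]⟩
  have hpol (y : sphere (0 : EuclideanSpace ℝ (Fin 2)) 1) :
      ∃ θ : ℝ, (y : EuclideanSpace ℝ (Fin 2)) = !₂[Real.cos θ, Real.sin θ] := by
    have hy := y.2
    rw [mem_sphere_zero_iff_norm, EuclideanSpace.norm_eq, Real.sqrt_eq_one, Fin.sum_univ_two] at hy
    simp only [Real.norm_eq_abs, sq_abs] at hy
    have hz : ‖(⟨y.1 0, y.1 1⟩ : ℂ)‖ = 1 := by
      rw [Complex.norm_def, Complex.normSq_mk, Real.sqrt_eq_one]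
      linarith
    refine ⟨Complex.arg ⟨y.1 0, y.1 1⟩, ?_⟩
    have h1 := Complex.norm_mul_cos_arg ⟨y.1 0, y.1 1⟩
    have h2 := Complex.norm_mul_sin_arg ⟨y.1 0, y.1 1⟩
    rw [hz, one_mul] at h1 h2
    ext i
    fin_cases i
    · simp [h1]
    · simp [h2]
  have hgu (y : sphere (0 : EuclideanSpace ℝ (Fin 2)) 1) (t : ℝ) (h0 : 0 ≤ t) (h1 : t ≤ 1) :
      (1 - t) • g y + t • u ≠ 0 := by
    intro h
    obtain ⟨θ, hθ⟩ := hpol y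
    rcases eq_or_ne t 0 with rfl | ht
    · have := hg y
      simp only [sub_zero, one_smul, zero_smul, add_zero] at h
      rw [h, dist_zero_left, hΓ' y] at this
      exact absurd (hε y) (not_le.2 this)
    · refine hu ⟨(-(t⁻¹ * (1 - t)), θ), ?_⟩
      simp only [cone, ← hθ]
      have h' : t • u = -((1 - t) • g y) := eq_neg_of_add_eq_zero_right h
      rw [neg_smul, mul_smul, ← smul_neg, ← h', smul_smul, inv_mul_cancel₀ ht, one_smul]
  have hφg (y : sphere (0 : EuclideanSpace ℝ (Fin 2)) 1) (t : ℝ) (h0 : 0 ≤ t) (h1 : t ≤ 1) :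
      (1 - t) • (φ y : W) + t • g y ≠ 0 := by
    intro h
    have h3 : (φ y : W) = t • ((φ y : W) - g y) := by
      have : (φ y : W) = ((1 - t) • (φ y : W) + t • g y) + t • ((φ y : W) - g y) := by module
      rwa [h, zero_add] at this
    have h4 := hg y
    rw [hΓ' y, dist_comm, dist_eq_norm] at h4
    have h5 : ‖(φ y : W)‖ ≤ ‖(φ y : W) - g y‖ := by
      conv_lhs => rw [h3]
      rw [norm_smul, Real.norm_of_nonneg h0]
      exact mul_le_of_le_one_left (norm_nonneg _) h1
    linarith [hε y]
  have hg0 (y : sphere (0 : EuclideanSpace ℝ (Fin 2)) 1) : g y ≠ 0 := by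
    simpa using hgu y 0 le_rfl zero_le_one
  have gc := gd.continuous
  let G : C(sphere (0 : EuclideanSpace ℝ (Fin 2)) 1, {w : W // w ≠ 0}) :=
    ⟨fun y ↦ ⟨g y, hg0 y⟩, Continuous.subtype_mk (gc.comp continuous_subtype_val) hg0⟩
  have H1 : φ.Homotopic G := ⟨
    { toFun := fun p ↦ ⟨_, hφg p.2 p.1 p.1.2.1 p.1.2.2⟩
      continuous_toFun := by
        refine Continuous.subtype_mk ?_ _
        fun_prop
      map_zero_left := fun y ↦ by simp
      map_one_left := fun y ↦ by simp [G] }⟩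
  have H2 : G.Homotopic (ContinuousMap.const _ ⟨u, hu0⟩) := ⟨
    { toFun := fun p ↦ ⟨_, hgu p.2 p.1 p.1.2.1 p.1.2.2⟩
      continuous_toFun := by
        refine Continuous.subtype_mk ?_ _
        fun_prop
      map_zero_left := fun y ↦ by simp [G]
      map_one_left := fun y ↦ by simp }⟩
  exact ⟨_, H1.trans H2⟩

theorem isCompact_solidCylinder : IsCompact solidCylinder :=
  (isCompact_closedBall 0 1).prod isCompact_Icc

theorem lateralSurface_subset_solidCylinder : lateralSurface ⊆ solidCylinder :=
  prod_mono sphere_subset_closedBall subset_rfl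

/-- A nonvanishing vector function on the lateral surface of the solid cylinder extends. -/
theorem exists_extension_solidCylinder {W : Type*} [NormedAddCommGroup W] [NormedSpace ℝ W]
    [FiniteDimensional ℝ W] (hW : 2 < Module.finrank ℝ W) {f : EuclideanSpace ℝ (Fin 2) × ℝ → W}
    (hf : ContinuousOn f lateralSurface) (hf0 : ∀ x ∈ lateralSurface, f x ≠ 0) :
    ∃ f' : EuclideanSpace ℝ (Fin 2) × ℝ → W, ContinuousOn f' solidCylinder ∧
      EqOn f' f lateralSurface ∧ ∀ x ∈ solidCylinder, f' x ≠ 0 := by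
  let F : C(lateralSurface, {w : W // w ≠ 0}) :=
    ⟨fun x ↦ ⟨f x, hf0 x x.2⟩, hf.domRestrict.subtype_mk _⟩
  let j : C(sphere (0 : EuclideanSpace ℝ (Fin 2)) 1, lateralSurface) :=
    ⟨fun y ↦ ⟨(y, 0), y.2, by simp⟩, by fun_prop⟩
  let p : C(lateralSurface, sphere (0 : EuclideanSpace ℝ (Fin 2)) 1) :=
    ⟨fun x ↦ ⟨x.1.1, x.2.1⟩, by fun_prop⟩
  -- The annulus deformation retracts onto its middle circle, so null-homotopy of loops suffices.
  have hid : (ContinuousMap.id lateralSurface).Homotopic (j.comp p) := ⟨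
    { toFun := fun x ↦ ⟨(x.2.1.1, (1 - x.1) * x.2.1.2), x.2.2.1, abs_le.1 (by
        have h1 := abs_le.2 x.2.2.2
        have h2 := x.1.2.1
        have h3 := x.1.2.2
        rw [abs_mul, abs_of_nonneg (by linarith)]
        exact mul_le_one₀ (by linarith) (abs_nonneg _) h1)⟩
      continuous_toFun := by fun_prop
      map_zero_left := fun x ↦ by simp
      map_one_left := fun x ↦ by simp [j, p] }⟩
  obtain ⟨u, hu⟩ := (nullhomotopic_circle hW (F.comp j)).comp_left p
  have hFu : F.Homotopic (ContinuousMap.const _ u) :=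
    ((ContinuousMap.Homotopic.refl F).comp hid).trans hu
  obtain ⟨H⟩ := hFu
  classical
  let Ĥ : ℝ × (EuclideanSpace ℝ (Fin 2) × ℝ) → W := fun a ↦
    if h : a.2 ∈ lateralSurface then H (projIcc 0 1 zero_le_one a.1, ⟨a.2, h⟩) else 0
  have hĤ : ContinuousOn Ĥ (univ ×ˢ lateralSurface) := by
    rw [continuousOn_iff_continuous_domRestrict]
    have : (univ ×ˢ lateralSurface).domRestrict Ĥ = fun a ↦
        (H (projIcc 0 1 zero_le_one a.1.1, ⟨a.1.2, a.2.2⟩) : W) := by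
      ext a
      exact dif_pos a.2.2
    rw [this]
    have := continuous_projIcc (a := (0 : ℝ)) (b := 1) (h := zero_le_one)
    fun_prop
  -- The null-homotopy is run radially: time `0` at radius `1`, time `1` at radius `1/2`, and the
  -- constant `u` further inside.
  let c : EuclideanSpace ℝ (Fin 2) × ℝ → ℝ × (EuclideanSpace ℝ (Fin 2) × ℝ) := fun x ↦
    (2 - 2 * ‖x.1‖, (‖x.1‖⁻¹ • x.1, x.2))
  have hcm (x) (hx : x ∈ solidCylinder) (hx0 : x.1 ≠ 0) : (c x).2 ∈ lateralSurface :=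
    ⟨by simp [c, norm_smul, hx0], hx.2⟩
  let f' : EuclideanSpace ℝ (Fin 2) × ℝ → W := fun x ↦ if ‖x.1‖ ≤ 1 / 2 then u else Ĥ (c x)
  have hne (x : EuclideanSpace ℝ (Fin 2) × ℝ) (hx : 1 / 2 ≤ ‖x.1‖) : x.1 ≠ 0 := by
    rw [← norm_pos_iff]
    linarith
  refine ⟨f', ?_, fun x hx ↦ ?_, fun x hx ↦ ?_⟩
  · have e : solidCylinder = (solidCylinder ∩ {x | ‖x.1‖ ≤ 1 / 2}) ∪
        (solidCylinder ∩ {x | 1 / 2 ≤ ‖x.1‖}) := by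
      rw [← inter_union_distrib_left]
      refine (inter_eq_left.2 fun x _ ↦ ?_).symm
      exact le_total ‖x.1‖ (1 / 2)
    have cl := isCompact_solidCylinder.isClosed
    rw [e]
    refine ContinuousOn.union_of_isClosed ?_ ?_
      (cl.inter (isClosed_le (by fun_prop) (by fun_prop)))
      (cl.inter (isClosed_le (by fun_prop) (by fun_prop)))
    · exact (continuousOn_const (c := (u : W))).congr fun x hx ↦ if_pos hx.2
    · refine (hĤ.comp (f := c) ?_ fun x hx ↦ ⟨mem_univ _, hcm x hx.1 (hne x hx.2)⟩).congr
        fun x hx ↦ ?_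
      · have : ContinuousOn (fun x : EuclideanSpace ℝ (Fin 2) × ℝ ↦ ‖x.1‖⁻¹)
            (solidCylinder ∩ {x | 1 / 2 ≤ ‖x.1‖}) :=
          ContinuousOn.inv₀ (by fun_prop) fun x hx ↦ norm_ne_zero_iff.2 (hne x hx.2)
        fun_prop
      · by_cases h : ‖x.1‖ ≤ 1 / 2
        · have h' : ‖x.1‖ = 1 / 2 := le_antisymm h hx.2
          have h1 : projIcc (0 : ℝ) 1 zero_le_one (c x).1 = 1 :=
            projIcc_of_right_le _ (by simp only [c, h']; norm_num)
          simp only [f', if_pos h, Function.comp, Ĥ, dif_pos (hcm x hx.1 (hne x hx.2)), h1]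
          simp
        · exact if_neg h
  · have h1 : ‖x.1‖ = 1 := by simpa using hx.1
    have h2 : c x = (0, x) := by simp [c, h1]
    have h3 : ¬ ‖x.1‖ ≤ 1 / 2 := by rw [h1]; norm_num
    simp only [f', if_neg h3, h2, Ĥ, dif_pos hx, projIcc_left]
    exact congr_arg Subtype.val (H.apply_zero ⟨x, hx⟩)
  · by_cases h : ‖x.1‖ ≤ 1 / 2
    · simpa only [f', if_pos h] using u.2
    · simp only [f', if_neg h, Ĥ, dif_pos (hcm x hx (hne x (not_le.1 h).le))]
      exact (H _).2

/-- The cone over a nonvanishing vector function on the unit sphere. -/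
theorem exists_extension_closedBall {V W : Type*} [NormedAddCommGroup V] [NormedSpace ℝ V]
    [ProperSpace V] [NormedAddCommGroup W] [NormedSpace ℝ W] {f : V → W}
    (hf : ContinuousOn f (sphere 0 1)) (hf0 : ∀ x ∈ sphere (0 : V) 1, f x ≠ 0) :
    ∃ f' : V → W, ContinuousOn f' (closedBall 0 1) ∧ EqOn f' f (sphere 0 1) ∧
      ∀ x ∈ closedBall 0 1, x ≠ 0 → f' x ≠ 0 := by
  have hm (x : V) (hx : x ≠ 0) : ‖x‖⁻¹ • x ∈ sphere (0 : V) 1 := by simp [norm_smul, hx]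
  refine ⟨fun x ↦ ‖x‖ • f (‖x‖⁻¹ • x), fun x _ ↦ ?_, fun x hx ↦ ?_, fun x _ hx ↦ ?_⟩
  · refine ContinuousAt.continuousWithinAt ?_
    rcases eq_or_ne x 0 with rfl | hx
    -- The direction has no limit at the origin, but `f` is bounded on the sphere and the factor
    -- `‖x‖` tends to zero.
    · obtain ⟨C, hC⟩ := (isCompact_sphere (0 : V) 1).exists_bound_of_continuousOn hf
      rw [ContinuousAt, norm_zero, zero_smul]
      refine squeeze_zero_norm (a := fun x ↦ ‖x‖ * C) (fun y ↦ ?_) ?_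
      · rcases eq_or_ne y 0 with rfl | hy
        · simp
        · rw [norm_smul, norm_norm]
          exact mul_le_mul_of_nonneg_left (hC _ (hm y hy)) (norm_nonneg _)
      · have : Continuous fun x : V ↦ ‖x‖ * C := by fun_prop
        simpa using this.tendsto 0
    · have h1 : ContinuousOn (fun x : V ↦ f (‖x‖⁻¹ • x)) {0}ᶜ := by
        refine hf.comp ?_ fun y hy ↦ hm y hy
        have : ContinuousOn (fun x : V ↦ ‖x‖⁻¹) {0}ᶜ :=
          ContinuousOn.inv₀ (by fun_prop) fun x hx ↦ norm_ne_zero_iff.2 hx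
        fun_prop
      exact continuous_norm.continuousAt.smul (h1.continuousAt (isOpen_compl_singleton.mem_nhds hx))
  · have : ‖x‖ = 1 := by simpa using hx
    simp [this]
  · exact smul_ne_zero (norm_ne_zero_iff.2 hx) (hf0 _ (hm x hx))

/-- An extension property for nonvanishing vector functions passes to nonvanishing sections of the
vector bundle given by the ranges of a continuous family of idempotents. -/
theorem exists_extension_idempotent {V G : Type*} [NormedAddCommGroup V] [NormedSpace ℝ V]
    [NormedAddCommGroup G] [NormedSpace ℝ G] [FiniteDimensional ℝ G] {S K Z : Set V}
    (hSK : S ⊆ K) (hK : IsCompact K) (hc : Convex ℝ K) (hne : K.Nonempty)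
    (ext : ∀ W : Submodule ℝ G, 2 < Module.finrank ℝ W → ∀ f : V → W, ContinuousOn f S →
      (∀ x ∈ S, f x ≠ 0) →
      ∃ f' : V → W, ContinuousOn f' K ∧ EqOn f' f S ∧ ∀ x ∈ K \ Z, f' x ≠ 0)
    {q : V → G →L[ℝ] G} (hq : ContinuousOn q K) (idem : ∀ x ∈ K, q x * q x = q x)
    (hrank : ∀ x ∈ K, 2 < Module.finrank ℝ (LinearMap.range (q x : G →ₗ[ℝ] G)))
    {f : V → G} (hf : ContinuousOn f S) (hqf : ∀ x ∈ S, q x (f x) = f x)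
    (hf0 : ∀ x ∈ S, f x ≠ 0) :
    ∃ f' : V → G, ContinuousOn f' K ∧ (∀ x ∈ K, q x (f' x) = f' x) ∧ EqOn f' f S ∧
      ∀ x ∈ K \ Z, f' x ≠ 0 := by
  obtain ⟨x₀, hx₀⟩ := hne
  have : CompleteSpace G := FiniteDimensional.complete ℝ G
  obtain ⟨u, uc, hu⟩ := exists_isUnit_conj_idempotent hK hc hx₀ hq idem
  have ic : ContinuousOn (fun x ↦ Ring.inverse (u x)) K := fun x hx ↦ by
    obtain ⟨a, ha⟩ := (hu x hx).1
    have := NormedRing.inverse_continuousAt a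
    rw [ha] at this
    exact this.comp_continuousWithinAt (uc x hx)
  have hi1 (x) (hx : x ∈ K) : u x * Ring.inverse (u x) = 1 := Ring.mul_inverse_cancel _ (hu x hx).1
  have hi2 (x) (hx : x ∈ K) : Ring.inverse (u x) * u x = 1 := Ring.inverse_mul_cancel _ (hu x hx).1
  have hiq (x) (hx : x ∈ K) : q x₀ * Ring.inverse (u x) = Ring.inverse (u x) * q x := by
    calc _ = Ring.inverse (u x) * (u x * q x₀) * Ring.inverse (u x) := by
          rw [← mul_assoc (Ring.inverse (u x)), hi2 x hx, one_mul]
      _ = _ := by rw [(hu x hx).2, mul_assoc, mul_assoc, hi1 x hx, mul_one]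
  have hmem (x) : q x₀ (Ring.inverse (u x) (f x)) ∈ LinearMap.range (q x₀ : G →ₗ[ℝ] G) :=
    ⟨_, rfl⟩
  have hval (x) (hx : x ∈ S) : q x₀ (Ring.inverse (u x) (f x)) = Ring.inverse (u x) (f x) := by
    have h : q x₀ (Ring.inverse (u x) (f x)) = Ring.inverse (u x) (q x (f x)) :=
      congr($(hiq x (hSK hx)) (f x))
    rwa [hqf x hx] at h
  have huv (x) (hx : x ∈ K) (w : G) : u x (Ring.inverse (u x) w) = w := congr($(hi1 x hx) w)
  have hvu (x) (hx : x ∈ K) (w : G) : Ring.inverse (u x) (u x w) = w := congr($(hi2 x hx) w)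
  -- Conjugation by `u` moves every fibre to the fixed subspace `range (q x₀)`, where the extension
  -- property for functions applies.
  obtain ⟨w, wc, hwf, hw0⟩ := ext _ (hrank x₀ hx₀)
    (fun x ↦ ⟨q x₀ (Ring.inverse (u x) (f x)), hmem x⟩)
    (Topology.IsInducing.subtypeVal.continuousOn_iff.2
      ((q x₀).continuous.comp_continuousOn ((ic.mono hSK).clm_apply hf)))
    (fun x hx h ↦ hf0 x hx (by
      have h' := congr_arg Subtype.val h
      simp only [hval x hx] at h'
      rw [← huv x (hSK hx) (f x), h']
      simp))
  refine ⟨fun x ↦ u x (w x), uc.clm_apply (continuous_subtype_val.comp_continuousOn wc),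
    fun x hx ↦ ?_, fun x hx ↦ ?_, fun x hx h ↦ hw0 x hx ?_⟩
  · have h1 : q x (u x (w x)) = u x (q x₀ (w x)) := congr($((hu x hx).2.symm) (w x : G))
    obtain ⟨a, ha⟩ := (w x).2
    have h2 : q x₀ (q x₀ a) = q x₀ a := congr($(idem x₀ hx₀) a)
    have h3 : q x₀ a = w x := ha
    rw [h3] at h2
    simp only [h1, h2]
  · simp only [hwf hx]
    rw [hval x hx, huv x (hSK hx)]
  · have := hvu x hx.1 (w x)
    exact Subtype.ext (by rw [← this, show u x (w x) = 0 from h]; simp)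

/-- Gluing of continuous functions along an embedded compact set. -/
theorem exists_continuousOn_union_image {X M G : Type*} [TopologicalSpace X] [TopologicalSpace M]
    [T2Space M] [TopologicalSpace G] {C : Set M} (hC : IsClosed C) {K : Set X} (hK : IsCompact K)
    {h : X → M} (hc : ContinuousOn h K) (hi : InjOn h K) {f : M → G} (hf : ContinuousOn f C)
    {k : X → G} (hk : ContinuousOn k K) (hfk : ∀ x ∈ K, h x ∈ C → k x = f (h x)) :
    ∃ f' : M → G, ContinuousOn f' (C ∪ h '' K) ∧ EqOn f' f C ∧ ∀ x ∈ K, f' (h x) = k x := by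
  classical
  rcases K.eq_empty_or_nonempty with rfl | ⟨x₁, hx₁⟩
  · exact ⟨f, by simpa using hf, fun _ _ ↦ rfl, by simp⟩
  have : Nonempty X := ⟨x₁⟩
  have hinv (x) (hx : x ∈ K) : Function.invFunOn h K (h x) = x := hi.leftInvOn_invFunOn hx
  have h2 (x) (hx : x ∈ K) :
      (if h x ∈ C then f (h x) else k (Function.invFunOn h K (h x))) = k x := by
    split_ifs with hxC
    · exact (hfk x hx hxC).symm
    · rw [hinv x hx]
  refine ⟨fun m ↦ if m ∈ C then f m else k (Function.invFunOn h K m), ?_,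
    fun m hm ↦ if_pos hm, h2⟩
  refine ContinuousOn.union_of_isClosed (hf.congr fun m hm ↦ if_pos hm) ?_ hC
    (hK.image_of_continuousOn hc).isClosed
  -- On `h '' K`, preimages of closed sets are images under `h` of compact sets, hence closed since
  -- `M` is Hausdorff.
  rw [continuousOn_iff_isClosed]
  intro T hT
  refine ⟨h '' (K ∩ k ⁻¹' T), ?_, ?_⟩
  · obtain ⟨D, hD, hDK⟩ := continuousOn_iff_isClosed.1 hk T hT
    rw [inter_comm, hDK, inter_comm]
    exact ((hK.inter_right hD).image_of_continuousOn (hc.mono inter_subset_left)).isClosed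
  · ext m
    constructor
    · rintro ⟨hm, x, hx, rfl⟩
      rw [mem_preimage, h2 x hx] at hm
      exact ⟨⟨x, ⟨hx, hm⟩, rfl⟩, x, hx, rfl⟩
    · rintro ⟨⟨x, ⟨hx, hxT⟩, rfl⟩, hm⟩
      refine ⟨?_, hm⟩
      rw [mem_preimage, h2 x hx]
      exact hxT

/-! ### Combinatorics of the handlebody and extension of sections handle by handle -/

namespace SolidHandlebody

variable {g : ℕ} {M : Type*} [TopologicalSpace M] [ChartedSpace (EuclideanHalfSpace 3) M]

theorem endDiscs_subset_solidCylinder : endDiscs ⊆ solidCylinder :=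
  prod_mono subset_rfl (by simp [insert_subset_iff])

theorem sphere_of_cell_mem_handle (D : SolidHandlebody g M) {i : Fin g}
    {y : EuclideanSpace ℝ (Fin 3)} (hy : y ∈ closedBall 0 1)
    (h : D.cell y ∈ D.handle i '' solidCylinder) : y ∈ sphere 0 1 := by
  have h1 : D.cell y ∈ D.handle i '' endDiscs := by
    rw [← D.handle_inter_cell i]
    exact ⟨h, y, hy, rfl⟩
  obtain ⟨z, hz, hzy⟩ := D.endDiscs_subset i h1
  rwa [← D.injOn_cell (sphere_subset_closedBall hz) hy hzy]

theorem sphere_of_cell_mem_boundary (D : SolidHandlebody g M) {y : EuclideanSpace ℝ (Fin 3)}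
    (hy : y ∈ closedBall 0 1) (h : D.cell y ∈ (𝓡∂ 3).boundary M) : y ∈ sphere 0 1 := by
  rw [D.boundary_eq] at h
  rcases h with ⟨⟨z, hz, hzy⟩, -⟩ | h
  · rwa [← D.injOn_cell (sphere_subset_closedBall hz) hy hzy]
  · obtain ⟨i, hi⟩ := mem_iUnion.1 h
    exact D.sphere_of_cell_mem_handle hy (image_mono lateralSurface_subset_solidCylinder hi)

/-- A handle point on the boundary sphere of the cell lies in an end disc; the open end discs are
removed from the boundary, which leaves only the rims, and these belong to the lateral surface. -/
theorem lateralSurface_of_handle_mem_boundary (D : SolidHandlebody g M) {i : Fin g}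
    {y : EuclideanSpace ℝ (Fin 2) × ℝ} (hy : y ∈ solidCylinder)
    (h : D.handle i y ∈ (𝓡∂ 3).boundary M) : y ∈ lateralSurface := by
  rw [D.boundary_eq] at h
  rcases h with ⟨⟨z, hz, hzy⟩, h⟩ | h
  · have h1 : D.handle i y ∈ D.handle i '' endDiscs := by
      rw [← D.handle_inter_cell i]
      exact ⟨⟨y, hy, rfl⟩, z, sphere_subset_closedBall hz, hzy⟩
    obtain ⟨w, hw, hwy⟩ := h1
    obtain rfl := D.injOn_handle i (endDiscs_subset_solidCylinder hw) hy hwy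
    refine ⟨?_, hy.2⟩
    by_contra hns
    refine h (mem_iUnion.2 ⟨i, w, ⟨?_, hw.2⟩, rfl⟩)
    exact lt_of_le_of_ne hw.1 hns
  · obtain ⟨j, z, hz, hzy⟩ := mem_iUnion.1 h
    have hz' := lateralSurface_subset_solidCylinder hz
    rcases eq_or_ne i j with rfl | hij
    · rwa [← D.injOn_handle i hz' hy hzy]
    · exact absurd hzy (fun e ↦ (D.disjoint_handles hij).le_bot ⟨⟨y, hy, rfl⟩, z, hz', e⟩)

theorem handle_lateralSurface_subset_boundary (D : SolidHandlebody g M) (i : Fin g) :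
    D.handle i '' lateralSurface ⊆ (𝓡∂ 3).boundary M := by
  rw [D.boundary_eq]
  exact subset_union_of_subset_right (subset_iUnion (fun i ↦ D.handle i '' lateralSurface) i) _

/-- Guarantees that a section defined over the boundary and all handles is defined on the whole
sphere of the cell, ready for coning. -/
theorem cell_sphere_subset (D : SolidHandlebody g M) :
    D.cell '' sphere 0 1 ⊆ (𝓡∂ 3).boundary M ∪ ⋃ i, D.handle i '' solidCylinder := by
  intro x hx
  by_cases h : x ∈ ⋃ i, D.handle i '' openEndDiscs
  · refine Or.inr (iUnion_mono (fun i ↦ image_mono ?_) h)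
    exact Subset.trans (prod_mono ball_subset_closedBall subset_rfl) endDiscs_subset_solidCylinder
  · rw [D.boundary_eq]
    exact Or.inl (Or.inl ⟨hx, h⟩)

theorem compactSpace (D : SolidHandlebody g M) : CompactSpace M := by
  refine ⟨?_⟩
  rw [← D.cover]
  exact ((isCompact_closedBall 0 1).image_of_continuousOn D.continuousOn_cell).union
    (isCompact_iUnion fun i ↦ isCompact_solidCylinder.image_of_continuousOn (D.continuousOn_handle i))

theorem centre_mem_interior (D : SolidHandlebody g M) : D.centre ∈ (𝓡∂ 3).interior M := by
  rw [← ModelWithCorners.compl_boundary]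
  intro h
  have := D.sphere_of_cell_mem_boundary (by simp) h
  simp at this

theorem handleInterior_subset_interior (D : SolidHandlebody g M) (i : Fin g) :
    D.handleInterior i ⊆ (𝓡∂ 3).interior M := by
  rw [← ModelWithCorners.compl_boundary]
  rintro _ ⟨y, hy, rfl⟩ h
  have := D.lateralSurface_of_handle_mem_boundary
    ⟨ball_subset_closedBall hy.1, Ioo_subset_Icc_self hy.2⟩ h
  exact (mem_ball.1 hy.1).ne (mem_sphere.1 this.1)

/-- A nonvanishing section over the boundary of a handlebody of the bundle of ranges of a family of
idempotents of rank at least three extends to a section with no zero but, possibly, the centre. -/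
theorem exists_section_extension [T2Space M] (D : SolidHandlebody g M)
    (hcl : IsClosed ((𝓡∂ 3).boundary M)) {G : Type*} [NormedAddCommGroup G] [NormedSpace ℝ G]
    [FiniteDimensional ℝ G] {q : M → G →L[ℝ] G} (hq : Continuous q)
    (idem : ∀ x, q x * q x = q x)
    (hrank : ∀ x, 2 < Module.finrank ℝ (LinearMap.range (q x : G →ₗ[ℝ] G)))
    {f : M → G} (hf : ContinuousOn f ((𝓡∂ 3).boundary M))
    (hqf : ∀ x ∈ (𝓡∂ 3).boundary M, q x (f x) = f x)
    (hf0 : ∀ x ∈ (𝓡∂ 3).boundary M, f x ≠ 0) :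
    ∃ f' : M → G, Continuous f' ∧ (∀ x, q x (f' x) = f' x) ∧ EqOn f' f ((𝓡∂ 3).boundary M) ∧
      ∀ x, x ≠ D.centre → f' x ≠ 0 := by
  classical
  -- Each handle meets the boundary and the handles already filled in its lateral surface only. Its
  -- end discs impose no condition, since the cell is filled last.
  have handles (s : Finset (Fin g)) : ∃ f' : M → G,
      ContinuousOn f' ((𝓡∂ 3).boundary M ∪ ⋃ i ∈ s, D.handle i '' solidCylinder) ∧
      (∀ x ∈ (𝓡∂ 3).boundary M ∪ ⋃ i ∈ s, D.handle i '' solidCylinder,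
        q x (f' x) = f' x ∧ f' x ≠ 0) ∧
      EqOn f' f ((𝓡∂ 3).boundary M) := by
    induction s using Finset.induction_on with
    | empty => exact ⟨f, by simpa using hf, by simpa using fun x hx ↦ ⟨hqf x hx, hf0 x hx⟩,
        fun _ _ ↦ rfl⟩
    | insert i s his ih =>
      obtain ⟨k, kc, hk, hkf⟩ := ih
      have hlat (y) (hy : y ∈ lateralSurface) : D.handle i y ∈ (𝓡∂ 3).boundary M :=
        D.handle_lateralSurface_subset_boundary i ⟨y, hy, rfl⟩
      obtain ⟨w, wc, hw, hwk, hw0⟩ := exists_extension_idempotent (Z := ∅)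
        lateralSurface_subset_solidCylinder isCompact_solidCylinder
        ((convex_closedBall _ _).prod (convex_Icc _ _)) ⟨(0, 0), by simp, by simp⟩
        (fun W hW f hf hf0 ↦ by simpa using exists_extension_solidCylinder hW hf hf0)
        (q := fun y ↦ q (D.handle i y)) (hq.comp_continuousOn (D.continuousOn_handle i))
        (fun _ _ ↦ idem _) (fun _ _ ↦ hrank _) (f := fun y ↦ k (D.handle i y))
        (kc.comp ((D.continuousOn_handle i).mono lateralSurface_subset_solidCylinder)
          fun y hy ↦ Or.inl (hlat y hy))
        (fun y hy ↦ (hk _ (Or.inl (hlat y hy))).1) (fun y hy ↦ (hk _ (Or.inl (hlat y hy))).2)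
      have hC : IsClosed ((𝓡∂ 3).boundary M ∪ ⋃ i ∈ s, D.handle i '' solidCylinder) :=
        hcl.union (isClosed_biUnion_finset fun j _ ↦
          (isCompact_solidCylinder.image_of_continuousOn (D.continuousOn_handle j)).isClosed)
      obtain ⟨k', k'c, hk'k, hk'w⟩ := exists_continuousOn_union_image hC isCompact_solidCylinder
        (D.continuousOn_handle i) (D.injOn_handle i) kc wc (fun y hy h ↦ by
          rcases h with h | h
          · exact hwk (D.lateralSurface_of_handle_mem_boundary hy h)
          · obtain ⟨j, hj, h⟩ := mem_iUnion₂.1 h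
            have hij : i ≠ j := fun e ↦ his (e ▸ hj)
            exact ((D.disjoint_handles hij).le_bot ⟨⟨y, hy, rfl⟩, h⟩).elim)
      have e : (𝓡∂ 3).boundary M ∪ ⋃ j ∈ insert i s, D.handle j '' solidCylinder =
          ((𝓡∂ 3).boundary M ∪ ⋃ j ∈ s, D.handle j '' solidCylinder) ∪
            D.handle i '' solidCylinder := by
        rw [Finset.set_biUnion_insert, union_comm (D.handle i '' _), union_assoc]
      rw [e]
      refine ⟨k', k'c, ?_, fun x hx ↦ (hk'k (Or.inl hx)).trans (hkf hx)⟩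
      rintro x (hx | ⟨y, hy, rfl⟩)
      · rw [hk'k hx]
        exact hk x hx
      · rw [hk'w y hy]
        exact ⟨hw y hy, hw0 y ⟨hy, notMem_empty y⟩⟩
  obtain ⟨k, kc, hk, hkf⟩ := handles Finset.univ
  simp only [Finset.mem_univ, iUnion_true] at kc hk
  have hS (y) (hy : y ∈ sphere (0 : EuclideanSpace ℝ (Fin 3)) 1) :=
    D.cell_sphere_subset ⟨y, hy, rfl⟩
  obtain ⟨w, wc, hw, hwk, hw0⟩ := exists_extension_idempotent (Z := {0})
    sphere_subset_closedBall (isCompact_closedBall (0 : EuclideanSpace ℝ (Fin 3)) 1)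
    (convex_closedBall _ _) ⟨0, by simp⟩
    (fun W hW f hf hf0 ↦ by
      simpa only [mem_sdiff, and_imp] using! exists_extension_closedBall hf hf0)
    (q := fun y ↦ q (D.cell y)) (hq.comp_continuousOn D.continuousOn_cell)
    (fun _ _ ↦ idem _) (fun _ _ ↦ hrank _) (f := fun y ↦ k (D.cell y))
    (kc.comp (D.continuousOn_cell.mono sphere_subset_closedBall) hS)
    (fun y hy ↦ (hk _ (hS y hy)).1) (fun y hy ↦ (hk _ (hS y hy)).2)
  have hC : IsClosed ((𝓡∂ 3).boundary M ∪ ⋃ i, D.handle i '' solidCylinder) :=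
    hcl.union (isClosed_iUnion_of_finite fun j ↦
      (isCompact_solidCylinder.image_of_continuousOn (D.continuousOn_handle j)).isClosed)
  obtain ⟨k', k'c, hk'k, hk'w⟩ := exists_continuousOn_union_image hC
    (isCompact_closedBall (0 : EuclideanSpace ℝ (Fin 3)) 1)
    D.continuousOn_cell D.injOn_cell kc wc (fun y hy h ↦ by
      rcases h with h | h
      · exact hwk (D.sphere_of_cell_mem_boundary hy h)
      · obtain ⟨j, h⟩ := mem_iUnion.1 h
        exact hwk (D.sphere_of_cell_mem_handle hy h))
  have hall (x : M) : x ∈ ((𝓡∂ 3).boundary M ∪ ⋃ i, D.handle i '' solidCylinder) ∪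
      D.cell '' closedBall 0 1 := by
    have : x ∈ D.cell '' closedBall 0 1 ∪ ⋃ i, D.handle i '' solidCylinder := D.cover ▸ mem_univ x
    exact this.elim Or.inr fun h ↦ Or.inl (Or.inr h)
  rw [eq_univ_of_forall hall, continuousOn_univ] at k'c
  refine ⟨k', k'c, fun x ↦ ?_, fun x hx ↦ (hk'k (Or.inl hx)).trans (hkf hx), fun x hx ↦ ?_⟩
  · rcases hall x with h | ⟨y, hy, rfl⟩
    · rw [hk'k h]
      exact (hk x h).1
    · rw [hk'w y hy]
      exact hw y hy
  · rcases hall x with h | ⟨y, hy, rfl⟩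
    · rw [hk'k h]
      exact (hk x h).2
    · rw [hk'w y hy]
      exact hw0 y ⟨hy, fun e ↦ hx (by rw [mem_singleton_iff.1 e]; rfl)⟩

end SolidHandlebody

/-! ### The tangent bundle as a direct summand of a trivial bundle -/

section TangentEmbedding

open Bundle Topology

variable {E H M : Type*} [NormedAddCommGroup E] [NormedSpace ℝ E] [TopologicalSpace H]
  (I : ModelWithCorners ℝ E H) [TopologicalSpace M] [ChartedSpace H M] {J : Type*}

/-- The fibrewise linear map from the tangent bundle to a trivial bundle given by finitely many
charts and weights. -/
noncomputable def tangentEmbedding [IsManifold I 1 M] (c : J → M) (σ : J → M → ℝ) (x : M) :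
    E →L[ℝ] (J → E) :=
  ContinuousLinearMap.pi fun j ↦ σ j x • tangentCoordChange I x (c j) x

/-- The fibrewise left inverse of `tangentEmbedding`. -/
noncomputable def tangentProjection [Fintype J] [IsManifold I 1 M] (c : J → M) (σ : J → M → ℝ)
    (x : M) : (J → E) →L[ℝ] E :=
  (∑ j, σ j x ^ 2)⁻¹ •
    ∑ j, (σ j x • tangentCoordChange I (c j) x x).comp (ContinuousLinearMap.proj j)

variable {I} {c : J → M} {σ : J → M → ℝ}

theorem tangentEmbedding_apply [IsManifold I 1 M] (x : M) (w : E) (j : J) :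
    tangentEmbedding I c σ x w j = σ j x • tangentCoordChange I x (c j) x w := rfl

theorem tangentProjection_apply [Fintype J] [IsManifold I 1 M] (x : M) (f : J → E) :
    tangentProjection I c σ x f =
      (∑ j, σ j x ^ 2)⁻¹ • ∑ j, σ j x • tangentCoordChange I (c j) x x (f j) := by
  rw [tangentProjection, smul_apply, sum_apply]
  rfl

theorem tangentProjection_tangentEmbedding [Fintype J] [IsManifold I 1 M]
    (hσ : ∀ j, tsupport (σ j) ⊆ (chartAt H (c j)).source) {x : M} (hx : ∃ j, σ j x ≠ 0) (w : E) :
    tangentProjection I c σ x (tangentEmbedding I c σ x w) = w := by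
  have h0 : ∑ j, σ j x ^ 2 ≠ 0 := by
    obtain ⟨j, hj⟩ := hx
    exact (Finset.sum_pos' (fun i _ ↦ sq_nonneg _) ⟨j, Finset.mem_univ j, by positivity⟩).ne'
  have h1 (j : J) : σ j x • tangentCoordChange I (c j) x x
      (σ j x • tangentCoordChange I x (c j) x w) = σ j x ^ 2 • w := by
    rcases eq_or_ne (σ j x) 0 with h | h
    · rw [h, zero_smul, sq, zero_mul, zero_smul]
    · have hj : x ∈ (extChartAt I (c j)).source := by
        rw [extChartAt_source]
        exact hσ j (subset_tsupport _ h)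
      rw [map_smul, tangentCoordChange_comp ⟨⟨mem_extChartAt_source x, hj⟩, mem_extChartAt_source x⟩,
        tangentCoordChange_self (mem_extChartAt_source x), smul_smul, sq]
  simp only [tangentProjection_apply, tangentEmbedding_apply, h1]
  rw [← Finset.sum_smul, smul_smul, inv_mul_cancel₀ h0, one_smul]

/-- On the support of `σ j` the component is a weighted local expression of `Y` in the chart at `c
j`; off the support it is locally zero. -/
theorem contMDiffAt_tangentEmbedding [Fintype J] [IsManifold I ∞ M] {n : ℕ∞}
    (hσ : ∀ j, tsupport (σ j) ⊆ (chartAt H (c j)).source)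
    (hσs : ∀ j, ContMDiff I 𝓘(ℝ) ∞ (σ j)) {Y : ∀ x : M, TangentSpace I x} {x₀ : M}
    (hY : ContMDiffAt I I.tangent n (fun x ↦ (⟨x, Y x⟩ : TangentBundle I M)) x₀) :
    ContMDiffAt I 𝓘(ℝ, J → E) n (fun x ↦ tangentEmbedding I c σ x (Y x)) x₀ := by
  rw [contMDiffAt_pi_space]
  intro j
  by_cases hj : x₀ ∈ tsupport (σ j)
  · have hb : x₀ ∈ (trivializationAt E (TangentSpace I) (c j)).baseSet := by
      rw [TangentBundle.trivializationAt_baseSet]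
      exact hσ j hj
    have := ((trivializationAt E (TangentSpace I) (c j)).contMDiffAt_section_iff (n := n)
      (IB := I) hb (s := Y)).1 hY
    exact ((hσs j).of_le (by exact_mod_cast le_top)).contMDiffAt.smul this
  · refine contMDiffAt_const (c := (0 : E)) |>.congr_of_eventuallyEq ?_
    filter_upwards [(isClosed_tsupport (σ j)).isOpen_compl.mem_nhds hj] with x hx
    change σ j x • (tangentCoordChange I x (c j) x (Y x) : E) = 0
    rw [image_eq_zero_of_notMem_tsupport hx, zero_smul]

/-- The two factors are written in the preferred chart at `x`, which may jump with `x`. In the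
composite this chart cancels: the `(i, j)` entry is `σ i * σ j` times the coordinate change from `c
j` to `c i`, divided by `∑ σ j ^ 2`. -/
theorem continuous_tangentEmbedding_comp_tangentProjection [Fintype J] [IsManifold I 1 M]
    (hσ : ∀ j, tsupport (σ j) ⊆ (chartAt H (c j)).source) (hσc : ∀ j, Continuous (σ j))
    (hx : ∀ x, ∃ j, σ j x ≠ 0) :
    Continuous fun x ↦
      (tangentEmbedding I c σ x).comp (tangentProjection I c σ x) := by
  classical
  have h0 (x : M) : ∑ j, σ j x ^ 2 ≠ 0 := by
    obtain ⟨j, hj⟩ := hx x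
    exact (Finset.sum_pos' (fun i _ ↦ sq_nonneg _) ⟨j, Finset.mem_univ j, by positivity⟩).ne'
  have hA (i j : J) : Continuous fun x ↦ (σ i x * σ j x) • tangentCoordChange I (c j) (c i) x := by
    rw [continuous_iff_continuousAt]
    intro x
    by_cases h : x ∈ tsupport (σ i) ∩ tsupport (σ j)
    · refine ((hσc i).mul (hσc j)).continuousAt.smul
        ((continuousOn_tangentCoordChange (c j) (c i)).continuousAt ?_)
      refine ((isOpen_extChartAt_source _).inter (isOpen_extChartAt_source _)).mem_nhds ?_
      simp only [extChartAt_source]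
      exact ⟨hσ j h.2, hσ i h.1⟩
    · refine continuousAt_const (y := (0 : E →L[ℝ] E)) |>.congr ?_
      filter_upwards [((isClosed_tsupport (σ i)).inter
        (isClosed_tsupport (σ j))).isOpen_compl.mem_nhds h] with y hy
      rcases not_and_or.1 hy with hy | hy <;>
        simp [image_eq_zero_of_notMem_tsupport hy]
  have e (x : M) : (tangentEmbedding I c σ x).comp (tangentProjection I c σ x) =
      (∑ j, σ j x ^ 2)⁻¹ • ∑ i, ∑ j,
        (ContinuousLinearMap.single ℝ (fun _ : J ↦ E) i).comp
          (((σ i x * σ j x) • tangentCoordChange I (c j) (c i) x).comp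
            (ContinuousLinearMap.proj j)) := by
    ext f k
    have h1 (j : J) : σ k x • (tangentCoordChange I x (c k) x
        (σ j x • tangentCoordChange I (c j) x x (f j)) : E) =
        (σ k x * σ j x) • tangentCoordChange I (c j) (c k) x (f j) := by
      rcases eq_or_ne (σ k x) 0 with hk | hk
      · simp [hk]
      rcases eq_or_ne (σ j x) 0 with hj | hj
      · simp [hj]
      rw [map_smul, tangentCoordChange_comp, smul_smul]
      simp only [extChartAt_source]
      exact ⟨⟨hσ j (subset_tsupport _ hj), mem_chart_source H x⟩, hσ k (subset_tsupport _ hk)⟩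
    have h2 : tangentEmbedding I c σ x (tangentProjection I c σ x f) k =
        (∑ j, σ j x ^ 2)⁻¹ • ∑ j, (σ k x * σ j x) • tangentCoordChange I (c j) (c k) x (f j) := by
      simp only [← h1]
      rw [tangentEmbedding_apply, tangentProjection_apply, map_smul, map_sum, smul_comm,
        Finset.smul_sum]
    simp only [ContinuousLinearMap.comp_apply]
    rw [h2]
    simp only [smul_apply, sum_apply,
      ContinuousLinearMap.comp_apply, Pi.smul_apply, Finset.sum_apply,
      ContinuousLinearMap.single_apply, ContinuousLinearMap.proj_apply]
    congr 1
    symm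
    refine (Finset.sum_eq_single k (fun i _ hi ↦ Finset.sum_eq_zero fun j _ ↦
      Pi.single_eq_of_ne hi.symm _) fun h ↦ absurd (Finset.mem_univ k) h).trans ?_
    exact Finset.sum_congr rfl fun j _ ↦ Pi.single_eq_same _ _
  simp only [e]
  refine Continuous.smul (Continuous.inv₀ (by fun_prop) h0) ?_
  refine continuous_finsetSum _ fun i _ ↦ continuous_finsetSum _ fun j _ ↦ ?_
  exact continuous_const.clm_comp ((hA i j).clm_comp continuous_const)

/-- A compact manifold has finitely many smooth weights, subordinate to charts, as needed for
`tangentEmbedding`. -/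
theorem exists_finite_chart_weights (I : ModelWithCorners ℝ E H) [FiniteDimensional ℝ E]
    (M : Type*) [TopologicalSpace M] [ChartedSpace H M]
    [IsManifold I ∞ M] [CompactSpace M] [T2Space M] :
    ∃ (s : Finset M) (σ : s → M → ℝ), (∀ j, ContMDiff I 𝓘(ℝ) ∞ (σ j)) ∧ (∀ j x, 0 ≤ σ j x) ∧
      (∀ j, tsupport (σ j) ⊆ (chartAt H (j : M)).source) ∧ ∀ x, ∃ j, σ j x ≠ 0 := by
  obtain ⟨ρ, hρ⟩ := SmoothPartitionOfUnity.exists_isSubordinate_chartAt_source I M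
  have hfin := ρ.locallyFinite.finite_nonempty_of_compact
  refine ⟨hfin.toFinset, fun j ↦ ρ j, fun j ↦ (ρ j).contMDiff, fun j x ↦ ρ.nonneg j x,
    fun j ↦ hρ j, fun x ↦ ?_⟩
  obtain ⟨i, hi⟩ := ρ.exists_pos_of_mem (mem_univ x)
  exact ⟨⟨i, hfin.mem_toFinset.2 ⟨x, hi.ne'⟩⟩, hi.ne'⟩

end TangentEmbedding

/-! ### Normal coordinates at the boundary -/

section HalfSpace

variable {n : ℕ} [NeZero n] {M : Type*} [TopologicalSpace M] [ChartedSpace (EuclideanHalfSpace n) M]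

theorem extChartAt_halfSpace_nonneg (c x : M) : 0 ≤ extChartAt (𝓡∂ n) c x 0 :=
  (chartAt (EuclideanHalfSpace n) c x).2

theorem mem_interior_iff_extChartAt_pos [IsManifold (𝓡∂ n) 1 M] {c x : M}
    (hx : x ∈ (chartAt (EuclideanHalfSpace n) c).source) :
    x ∈ (𝓡∂ n).interior M ↔ 0 < extChartAt (𝓡∂ n) c x 0 := by
  have hr := interior_range_modelWithCornersEuclideanHalfSpace n
  have h := (𝓡∂ n).isInteriorPoint_iff_of_mem_atlas (n := 1) one_ne_zero
    (chart_mem_atlas (EuclideanHalfSpace n) c) hx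
  refine h.trans ⟨fun h' ↦ ?_, fun h' ↦ ?_⟩
  · have := interior_mono ((chartAt (EuclideanHalfSpace n) c).extend_target_subset_range) h'
    rw [hr] at this
    exact this
  · refine OpenPartialHomeomorph.mem_interior_extend_target _
      ((chartAt (EuclideanHalfSpace n) c).map_source hx) ?_
    rw [hr]
    exact h'

theorem mem_boundary_iff_extChartAt_eq_zero [IsManifold (𝓡∂ n) 1 M] {c x : M}
    (hx : x ∈ (chartAt (EuclideanHalfSpace n) c).source) :
    x ∈ (𝓡∂ n).boundary M ↔ extChartAt (𝓡∂ n) c x 0 = 0 := by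
  rw [← ModelWithCorners.compl_interior, mem_compl_iff, mem_interior_iff_extChartAt_pos hx, not_lt]
  exact ⟨fun h ↦ le_antisymm h (extChartAt_halfSpace_nonneg c x), le_of_eq⟩

/-- At boundary points, coordinate changes scale the normal component of tangent vectors by a
positive factor. -/
theorem exists_pos_tangentCoordChange_apply_zero [IsManifold (𝓡∂ n) 1 M] {c x : M}
    (hb : x ∈ (𝓡∂ n).boundary M) (hx : x ∈ (chartAt (EuclideanHalfSpace n) c).source) :
    ∃ a > 0, ∀ w : EuclideanSpace ℝ (Fin n),
      tangentCoordChange (𝓡∂ n) x c x w 0 = a * w 0 := by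
  have hx' : x ∈ (extChartAt (𝓡∂ n) c).source := by rwa [extChartAt_source]
  have hD := hasFDerivWithinAt_tangentCoordChange (I := 𝓡∂ n)
    (x := x) (y := c) (z := x) ⟨mem_extChartAt_source x, hx'⟩
  have hP := ((EuclideanSpace.proj (𝕜 := ℝ) (0 : Fin n)).hasFDerivAt (x :=
    (extChartAt (𝓡∂ n) c ∘ (extChartAt (𝓡∂ n) x).symm) (extChartAt (𝓡∂ n) x x))).comp_hasFDerivWithinAt _ hD
  have h0 : extChartAt (𝓡∂ n) x x 0 = 0 :=
    (mem_boundary_iff_extChartAt_eq_zero (mem_chart_source _ x)).1 hb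
  -- The normal coordinate of the chart at `c` is nonnegative and vanishes at `x`, so its derivative
  -- is nonnegative on inward vectors and zero on tangential ones.
  have hmin : IsLocalMinOn (EuclideanSpace.proj (𝕜 := ℝ) (0 : Fin n) ∘
      (extChartAt (𝓡∂ n) c ∘ (extChartAt (𝓡∂ n) x).symm)) (range (𝓡∂ n))
      (extChartAt (𝓡∂ n) x x) := by
    refine Filter.Eventually.of_forall fun y ↦ ?_
    simp only [Function.comp, extChartAt_to_inv]
    change extChartAt (𝓡∂ n) c x 0 ≤ extChartAt (𝓡∂ n) c ((extChartAt (𝓡∂ n) x).symm y) 0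
    rw [(mem_boundary_iff_extChartAt_eq_zero hx).1 hb]
    exact extChartAt_halfSpace_nonneg _ _
  have key (w : EuclideanSpace ℝ (Fin n)) (hw : 0 ≤ w 0) :
      0 ≤ tangentCoordChange (𝓡∂ n) x c x w 0 := by
    refine hmin.hasFDerivWithinAt_nonneg hP (mem_posTangentConeAt_of_segment_subset ?_)
    refine (𝓡∂ n).convex_range.segment_subset ⟨_, rfl⟩ ?_
    rw [range_modelWithCornersEuclideanHalfSpace, mem_ofPred_eq, PiLp.add_apply, h0, zero_add]
    exact hw
  have key0 (w : EuclideanSpace ℝ (Fin n)) (hw : w 0 = 0) :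
      tangentCoordChange (𝓡∂ n) x c x w 0 = 0 := by
    have h2 := key (-w) (by simp [hw])
    rw [map_neg, PiLp.neg_apply] at h2
    exact le_antisymm (by linarith) (key w hw.ge)
  set e : EuclideanSpace ℝ (Fin n) := EuclideanSpace.single 0 1 with he
  have lin (w : EuclideanSpace ℝ (Fin n)) : tangentCoordChange (𝓡∂ n) x c x w 0 =
      tangentCoordChange (𝓡∂ n) x c x e 0 * w 0 := by
    have h1 := key0 (w - w 0 • e) (by simp [he])
    rw [map_sub, map_smul, PiLp.sub_apply, PiLp.smul_apply, smul_eq_mul] at h1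
    linarith
  -- A zero factor would contradict invertibility of the coordinate change.
  refine ⟨_, lt_of_le_of_ne (key e (by simp [he])) fun h ↦ ?_, lin⟩
  have h1 := lin (tangentCoordChange (𝓡∂ n) c x x e)
  rw [tangentCoordChange_comp ⟨⟨hx', mem_extChartAt_source x⟩, hx'⟩,
    tangentCoordChange_self hx', ← h, zero_mul] at h1
  simp [he] at h1

end HalfSpace

/-! ### The covector field -/

namespace SolidHandlebody

open Topology

variable {g : ℕ} {M : Type*} [TopologicalSpace M] [ChartedSpace (EuclideanHalfSpace 3) M]

/-- A handlebody carries a continuous field of covectors without zeros off the centre, which near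
the boundary is smooth and on the boundary is a positive multiple of the conormal. -/
theorem exists_covectorField [T2Space M] [IsManifold (𝓡∂ 3) ∞ M] (D : SolidHandlebody g M) :
    ∃ Λ : M → EuclideanSpace ℝ (Fin 3) →L[ℝ] ℝ,
      (∀ (n : ℕ∞) (Y : ∀ x : M, TangentSpace (𝓡∂ 3) x) (x₀ : M),
        ContMDiffAt (𝓡∂ 3) (𝓡∂ 3).tangent n (fun x ↦ (⟨x, Y x⟩ : TangentBundle (𝓡∂ 3) M)) x₀ →
        ContinuousAt (fun x ↦ Λ x (Y x)) x₀) ∧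
      (∀ x, x ≠ D.centre → Λ x ≠ 0) ∧
      ∃ U : Set M, IsOpen U ∧ (𝓡∂ 3).boundary M ⊆ U ∧
        (∀ (n : ℕ∞) (Y : ∀ x : M, TangentSpace (𝓡∂ 3) x), ∀ x₀ ∈ U,
          ContMDiffAt (𝓡∂ 3) (𝓡∂ 3).tangent n (fun x ↦ (⟨x, Y x⟩ : TangentBundle (𝓡∂ 3) M)) x₀ →
          ContMDiffAt (𝓡∂ 3) 𝓘(ℝ) n (fun x ↦ Λ x (Y x)) x₀) ∧
        ∀ x ∈ (𝓡∂ 3).boundary M, ∃ a > 0, ∀ w, Λ x w = a * w 0 := by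
  classical
  have := D.compactSpace
  have hcl : IsClosed ((𝓡∂ 3).boundary M) := (𝓡∂ 3).isClosed_boundary (n := ∞) (by simp)
  obtain ⟨s, σ, hσs, hσ0, hσ, hx⟩ := exists_finite_chart_weights (𝓡∂ 3) M
  let c : s → M := fun j ↦ j
  let τ (x : M) := tangentEmbedding (𝓡∂ 3) c σ x
  let π (x : M) := tangentProjection (𝓡∂ 3) c σ x
  have hπτ (x : M) (w) : π x (τ x w) = w := tangentProjection_tangentEmbedding hσ (hx x) w
  have hPc : Continuous fun x ↦ (τ x).comp (π x) :=
    continuous_tangentEmbedding_comp_tangentProjection hσ (fun j ↦ (hσs j).continuous) hx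
  -- Dually, covectors at `x` are the functionals on the trivial fibre that factor through `π x`;
  -- precomposition with `τ x ∘ π x` projects onto them.
  let q (x : M) : ((s → EuclideanSpace ℝ (Fin 3)) →L[ℝ] ℝ) →L[ℝ]
      ((s → EuclideanSpace ℝ (Fin 3)) →L[ℝ] ℝ) :=
    (ContinuousLinearMap.compL ℝ (s → EuclideanSpace ℝ (Fin 3)) (s → EuclideanSpace ℝ (Fin 3))
      ℝ).flip ((τ x).comp (π x))
  have hq (x : M) (ξ) (f) : q x ξ f = ξ (τ x (π x f)) := rfl
  have hqc : Continuous q := (ContinuousLinearMap.continuous _).comp hPc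
  have idem (x : M) : q x * q x = q x := by
    ext ξ f
    change ξ (τ x (π x (τ x (π x f)))) = ξ (τ x (π x f))
    rw [hπτ]
  have hrank (x : M) : 2 < Module.finrank ℝ (LinearMap.range
      (q x : ((s → EuclideanSpace ℝ (Fin 3)) →L[ℝ] ℝ) →ₗ[ℝ]
        ((s → EuclideanSpace ℝ (Fin 3)) →L[ℝ] ℝ))) := by
    let T : EuclideanSpace ℝ (Fin 3) →ₗ[ℝ] LinearMap.range
        (q x : ((s → EuclideanSpace ℝ (Fin 3)) →L[ℝ] ℝ) →ₗ[ℝ]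
        ((s → EuclideanSpace ℝ (Fin 3)) →L[ℝ] ℝ)) :=
      { toFun := fun w ↦ ⟨(innerSL ℝ w).comp (π x), (innerSL ℝ w).comp (π x), by
          ext f
          change inner ℝ w (π x (τ x (π x f))) = inner ℝ w (π x f)
          rw [hπτ]⟩
        map_add' := fun a b ↦ by
          ext f
          simp
        map_smul' := fun a b ↦ by
          ext f
          simp }
    have hT : Function.Injective T := by
      rw [injective_iff_map_eq_zero]
      intro w hw
      have h1 : (innerSL ℝ w).comp (π x) = 0 := congr_arg Subtype.val hw
      have h2 : inner ℝ w (π x (τ x w)) = 0 := congr($h1 (τ x w))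
      rwa [hπτ, inner_self_eq_zero] at h2
    have := LinearMap.finrank_le_finrank_of_injective hT
    rw [finrank_euclideanSpace_fin] at this
    omega
  -- The sum of all normal components. All the coordinate changes preserve the inward direction, so
  -- on the boundary `ℓ ∘ τ x` is a positive multiple of the conormal.
  let ℓ : (s → EuclideanSpace ℝ (Fin 3)) →L[ℝ] ℝ :=
    ∑ j, (EuclideanSpace.proj (0 : Fin 3)).comp (ContinuousLinearMap.proj j)
  have hℓ (f) : ℓ f = ∑ j, f j 0 := by
    simp [ℓ]
  have hbd (x : M) (hxb : x ∈ (𝓡∂ 3).boundary M) : ∃ a > 0, ∀ w, ℓ (τ x w) = a * w 0 := by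
    have h1 (j : s) : ∃ a : ℝ, 0 ≤ a ∧ (σ j x ≠ 0 → 0 < a) ∧ ∀ w, τ x w j 0 = a * w 0 := by
      rcases eq_or_ne (σ j x) 0 with h | h
      · refine ⟨0, le_rfl, fun h' ↦ (h' h).elim, fun w ↦ ?_⟩
        simp only [τ]
        rw [tangentEmbedding_apply, h, zero_smul, zero_mul]
        rfl
      · obtain ⟨a, a0, ha⟩ := exists_pos_tangentCoordChange_apply_zero hxb
          (hσ j (subset_tsupport _ h))
        have h' := lt_of_le_of_ne (hσ0 j x) h.symm
        refine ⟨σ j x * a, by positivity, fun _ ↦ by positivity, fun w ↦ ?_⟩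
        simp only [τ]
        rw [tangentEmbedding_apply, PiLp.smul_apply, ha, smul_eq_mul, mul_assoc]
    choose a ha0 hap ha using h1
    obtain ⟨j, hj⟩ := hx x
    refine ⟨∑ j, a j, Finset.sum_pos' (fun j _ ↦ ha0 j) ⟨j, Finset.mem_univ j, hap j hj⟩,
      fun w ↦ ?_⟩
    simp only [hℓ, ha, Finset.sum_mul]
  let ξ₀ (x : M) := q x ℓ
  have hξ₀c : Continuous ξ₀ := hqc.clm_apply continuous_const
  have hqξ₀ (x : M) : q x (ξ₀ x) = ξ₀ x := congr($(idem x) ℓ)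
  have hξ₀τ (x : M) (w) : ξ₀ x (τ x w) = ℓ (τ x w) := by
    simp only [ξ₀, hq, hπτ]
  have hξ₀0 (x : M) (hxb : x ∈ (𝓡∂ 3).boundary M) : ξ₀ x ≠ 0 := by
    intro h
    obtain ⟨a, a0, ha⟩ := hbd x hxb
    have := ha (EuclideanSpace.single 0 1)
    rw [← hξ₀τ, h] at this
    simp [a0.ne] at this
  obtain ⟨ξ, ξc, hqξ, hξξ₀, hξ0⟩ := D.exists_section_extension hcl hqc idem hrank
    hξ₀c.continuousOn (fun x _ ↦ hqξ₀ x) hξ₀0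
  -- The extension `ξ` agrees with the smooth model `ξ₀` only on the boundary. Interpolating where
  -- `‖ξ - ξ₀‖ < ‖ξ₀‖` creates no zeros and yields agreement on a neighbourhood `U`.
  have hVo : IsOpen {x | ‖ξ x - ξ₀ x‖ < ‖ξ₀ x‖} := isOpen_lt (by fun_prop) (by fun_prop)
  obtain ⟨U, hUo, hbU, hUV⟩ := normal_exists_closure_subset hcl hVo (fun x hxb ↦ by
    rw [mem_ofPred_eq, hξξ₀ hxb, sub_self, norm_zero]
    exact norm_pos_iff.2 (hξ₀0 x hxb))
  obtain ⟨ψ, hψ0, hψ1, hψ⟩ := exists_continuous_zero_one_of_isClosed isClosed_closure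
    hVo.isClosed_compl (disjoint_compl_right_iff_subset.2 hUV)
  let ξ' (x : M) := ξ₀ x + ψ x • (ξ x - ξ₀ x)
  have hξ'c : Continuous ξ' := by fun_prop
  have hqξ' (x : M) : q x (ξ' x) = ξ' x := by
    simp only [ξ', map_add, map_smul, map_sub, hqξ, hqξ₀]
  have hξ'0 (x : M) (hxc : x ≠ D.centre) : ξ' x ≠ 0 := by
    by_cases hxV : ‖ξ x - ξ₀ x‖ < ‖ξ₀ x‖
    · intro h
      have h1 : ‖ξ₀ x‖ = ‖ψ x • (ξ x - ξ₀ x)‖ := by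
        refine (congr_arg norm (eq_neg_of_add_eq_zero_left h)).trans (norm_neg _)
      rw [norm_smul, Real.norm_of_nonneg (hψ x).1] at h1
      have := mul_le_of_le_one_left (norm_nonneg (ξ x - ξ₀ x)) (hψ x).2
      linarith
    · have : ψ x = 1 := hψ1 hxV
      simpa [ξ', this] using hξ0 x hxc
  refine ⟨fun x ↦ (ξ' x).comp (τ x), fun n Y x₀ hY ↦ ?_, fun x hxc h ↦ hξ'0 x hxc ?_,
    U, hUo, hbU, fun n Y x₀ hx₀ hY ↦ ?_, fun x hxb ↦ ?_⟩
  · exact hξ'c.continuousAt.clm_apply (contMDiffAt_tangentEmbedding hσ hσs hY).continuousAt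
  · rw [← hqξ' x]
    ext f
    exact congr($h (π x f))
  · have h1 := ℓ.contMDiff.contMDiffAt.comp x₀ (contMDiffAt_tangentEmbedding hσ hσs hY)
    refine h1.congr_of_eventuallyEq ?_
    filter_upwards [hUo.mem_nhds hx₀] with x hxU
    have : ψ x = 0 := hψ0 (subset_closure hxU)
    change (ξ₀ x + ψ x • (ξ x - ξ₀ x)) (τ x (Y x)) = ℓ (τ x (Y x))
    rw [this, zero_smul, add_zero]
    exact hξ₀τ x (Y x)
  · obtain ⟨a, a0, ha⟩ := hbd x hxb
    refine ⟨a, a0, fun w ↦ ?_⟩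
    have : ψ x = 0 := hψ0 (subset_closure (hbU hxb))
    change (ξ₀ x + ψ x • (ξ x - ξ₀ x)) (τ x w) = a * w 0
    rw [this, zero_smul, add_zero, hξ₀τ, ha]

end SolidHandlebody

/-! ### Retractions onto embedded submanifolds, and positive fields in the interior -/

section LocalFields

open Bundle Topology

/-- A smooth embedding of a manifold without boundary has local smooth retractions. -/
theorem Manifold.IsSmoothEmbedding.exists_local_retraction {m : ℕ} {E H M S : Type*}
    [NormedAddCommGroup E] [NormedSpace ℝ E] [TopologicalSpace H] {I : ModelWithCorners ℝ E H}
    [TopologicalSpace M] [ChartedSpace H M] [IsManifold I ∞ M] [TopologicalSpace S]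
    [ChartedSpace (EuclideanSpace ℝ (Fin m)) S] [IsManifold (𝓡 m) ∞ S] {ι : S → M}
    (hι : Manifold.IsSmoothEmbedding (𝓡 m) I ∞ ι) (s₀ : S) :
    ∃ (ret : M → S) (U : Set M), IsOpen U ∧ ι s₀ ∈ U ∧ ContMDiffOn I (𝓡 m) ∞ ret U ∧
      ∀ s, ι s ∈ U → ret (ι s) = s := by
  have h := hι.isImmersion.isImmersionAt s₀
  -- `W` excludes other sheets of `ι`: points of `S` mapped into `W` lie in the domain chart, where
  -- `ι` reads `y ↦ (y, 0)`.
  obtain ⟨W, hW, hWs⟩ := hι.isEmbedding.isInducing.isOpen_iff.1 h.domChart.open_source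
  let k : M → EuclideanSpace ℝ (Fin m) := fun x ↦ (h.equiv.symm (h.codChart.extend I x)).1
  have hk : ContMDiffOn I 𝓘(ℝ, EuclideanSpace ℝ (Fin m)) ∞ k h.codChart.source := by
    have h1 := OpenPartialHomeomorph.contMDiffOn_extend (I := I) (n := ∞) h.codChart_mem_maximalAtlas
    have h2 : ContDiff ℝ ∞ fun y ↦ (h.equiv.symm y).1 :=
      contDiff_fst.comp h.equiv.symm.contDiff
    exact h2.contMDiff.comp_contMDiffOn h1
  have hkι (s) (hs : s ∈ h.domChart.source) : k (ι s) = h.domChart s := by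
    have h0 : h.domChart s ∈ (h.domChart.extend (𝓡 m)).target := by
      simpa [mfld_simps] using h.domChart.map_source hs
    have h1 := h.writtenInCharts h0
    have h2 : h.codChart.extend I (ι s) = h.equiv (h.domChart s, 0) := by
      simpa [h.domChart.left_inv hs] using h1
    simp only [k, h2, ContinuousLinearEquiv.symm_apply_apply]
  refine ⟨fun x ↦ h.domChart.symm (k x), (h.codChart.source ∩ k ⁻¹' h.domChart.target) ∩ W,
    (hk.continuousOn.isOpen_inter_preimage h.codChart.open_source h.domChart.open_target).inter hW,
    ⟨⟨h.mem_codChart_source, ?_⟩, ?_⟩, ?_, fun s hs ↦ ?_⟩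
  · rw [mem_preimage, hkι s₀ h.mem_domChart_source]
    exact h.domChart.map_source h.mem_domChart_source
  · change s₀ ∈ ι ⁻¹' W
    rw [hWs]
    exact h.mem_domChart_source
  · exact (contMDiffOn_symm_of_mem_maximalAtlas h.domChart_mem_maximalAtlas).comp
      (hk.mono fun x hx ↦ hx.1.1) fun x hx ↦ hx.1.2
  · have hs' : s ∈ h.domChart.source := by
      rw [← hWs]
      exact hs.2
    exact (congr_arg _ (hkι s hs')).trans (h.domChart.left_inv hs')

/-- The differential of a local retraction is a left inverse. -/
theorem Manifold.IsSmoothEmbedding.mfderiv_injective {m : ℕ} {E H M S : Type*}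
    [NormedAddCommGroup E] [NormedSpace ℝ E] [TopologicalSpace H] {I : ModelWithCorners ℝ E H}
    [TopologicalSpace M] [ChartedSpace H M] [IsManifold I ∞ M] [TopologicalSpace S]
    [ChartedSpace (EuclideanSpace ℝ (Fin m)) S] [IsManifold (𝓡 m) ∞ S] {ι : S → M}
    (hι : Manifold.IsSmoothEmbedding (𝓡 m) I ∞ ι) (s : S) :
    Function.Injective (mfderiv (𝓡 m) I ι s) := by
  obtain ⟨ret, U, hU, hs, hret, hrι⟩ := hι.exists_local_retraction s
  have h1 : MDifferentiableAt I (𝓡 m) ret (ι s) :=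
    (hret.contMDiffAt (hU.mem_nhds hs)).mdifferentiableAt (by simp)
  have h2 : MDifferentiableAt (𝓡 m) I ι s := hι.contMDiff.mdifferentiableAt (by simp)
  have h3 : ret ∘ ι =ᶠ[𝓝 s] id := by
    filter_upwards [hι.contMDiff.continuous.continuousAt.preimage_mem_nhds (hU.mem_nhds hs)]
      with t ht using hrι t ht
  have h4 := mfderiv_comp s h1 h2
  rw [h3.mfderiv_eq, mfderiv_id] at h4
  intro a b hab
  have ha := congr($h4 a)
  have hb := congr($h4 b)
  exact ha.trans ((congr_arg (mfderiv I (𝓡 m) ret (ι s)) hab).trans hb.symm)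

/-- Tangent vectors to a surface in the boundary have no normal component. -/
theorem mfderiv_apply_zero_of_range_subset_boundary {m n : ℕ} [NeZero n] {M S : Type*}
    [TopologicalSpace M] [ChartedSpace (EuclideanHalfSpace n) M] [IsManifold (𝓡∂ n) 1 M]
    [TopologicalSpace S] [ChartedSpace (EuclideanSpace ℝ (Fin m)) S] {ι : S → M}
    (hι : range ι ⊆ (𝓡∂ n).boundary M) {s : S} (hs : MDifferentiableAt (𝓡 m) (𝓡∂ n) ι s)
    (w : EuclideanSpace ℝ (Fin m)) :
    EuclideanSpace.proj (𝕜 := ℝ) (0 : Fin n) (mfderiv (𝓡 m) (𝓡∂ n) ι s w) = 0 := by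
  have h1 := hs.hasMFDerivAt.2
  rw [modelWithCornersSelf_coe, range_id] at h1
  replace h1 := hasFDerivWithinAt_univ.1 h1
  have h2 := ((EuclideanSpace.proj (𝕜 := ℝ) (0 : Fin n)).hasFDerivAt (x :=
    writtenInExtChartAt (𝓡 m) (𝓡∂ n) s ι (extChartAt (𝓡 m) s s))).comp _ h1
  have h3 : (EuclideanSpace.proj (𝕜 := ℝ) (0 : Fin n)) ∘ writtenInExtChartAt (𝓡 m) (𝓡∂ n) s ι
      =ᶠ[𝓝 (extChartAt (𝓡 m) s s)] fun _ ↦ 0 := by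
    have hc : ContinuousAt (ι ∘ (extChartAt (𝓡 m) s).symm) (extChartAt (𝓡 m) s s) := by
      refine ContinuousAt.comp ?_ (continuousAt_extChartAt_symm s)
      rw [extChartAt_to_inv]
      exact hs.continuousAt
    have hm : (chartAt (EuclideanHalfSpace n) (ι s)).source ∈
        𝓝 ((ι ∘ (extChartAt (𝓡 m) s).symm) (extChartAt (𝓡 m) s s)) := by
      rw [Function.comp, extChartAt_to_inv]
      exact chart_source_mem_nhds _ _
    filter_upwards [hc.preimage_mem_nhds hm] with y hy
    exact (mem_boundary_iff_extChartAt_eq_zero hy).1 (hι ⟨_, rfl⟩)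
  have h4 := h2.unique ((hasFDerivAt_const (0 : ℝ) _).congr_of_eventuallyEq h3)
  exact congr($h4 w)

variable {M : Type*} [TopologicalSpace M] [ChartedSpace (EuclideanHalfSpace 3) M]
  [IsManifold (𝓡∂ 3) ∞ M]

/-- Near interior points there are smooth vector fields vanishing on a given closed set and positive
off this set with respect to a given continuous field of nonzero covectors. -/
theorem exists_local_positive_field [T2Space M] [SigmaCompactSpace M] {r : ℕ∞}
    {Λ : M → EuclideanSpace ℝ (Fin 3) →L[ℝ] ℝ}
    (hΛ : ∀ (n : ℕ∞) (Y : ∀ x : M, TangentSpace (𝓡∂ 3) x) (x₀ : M),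
      ContMDiffAt (𝓡∂ 3) (𝓡∂ 3).tangent n (fun x ↦ (⟨x, Y x⟩ : TangentBundle (𝓡∂ 3) M)) x₀ →
      ContinuousAt (fun x ↦ Λ x (Y x)) x₀)
    {F : Set M} (hF : IsClosed F) (hΛ0 : ∀ x ∉ F, Λ x ≠ 0) (x₀ : M) :
    ∃ U ∈ 𝓝 x₀, ∃ Y : ∀ x : M, TangentSpace (𝓡∂ 3) x,
      ContMDiffOn (𝓡∂ 3) (𝓡∂ 3).tangent r (fun x ↦ (⟨x, Y x⟩ : TangentBundle (𝓡∂ 3) M)) U ∧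
      ∀ x ∈ U, (x ∈ F → Y x = 0) ∧ (x ∉ F → 0 < Λ x (Y x)) := by
  let e := trivializationAt (EuclideanSpace ℝ (Fin 3)) (TangentSpace (𝓡∂ 3)) x₀
  let b := (EuclideanSpace.basisFun (Fin 3) ℝ).toBasis
  let Z (j : Fin 3) : ∀ x : M, TangentSpace (𝓡∂ 3) x := e.localFrame b j
  have hZ (j : Fin 3) : ContMDiffOn (𝓡∂ 3) (𝓡∂ 3).tangent r
      (fun x ↦ (⟨x, Z j x⟩ : TangentBundle (𝓡∂ 3) M)) e.baseSet :=
    e.contMDiffOn_localFrame_baseSet (I := 𝓡∂ 3) r b j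
  have hcont (j : Fin 3) : ContinuousOn (fun x ↦ Λ x (Z j x)) (e.baseSet \ F) := fun x hx ↦
    (hΛ r (Z j) x ((hZ j).contMDiffAt (e.open_baseSet.mem_nhds hx.1))).continuousWithinAt
  have hop : IsOpen (e.baseSet \ F) := e.open_baseSet.sdiff hF
  -- As `Λ(Z j)` is only continuous, it cannot serve as a coefficient. Nonnegative `C^r` functions
  -- supported exactly where it is positive, respectively negative, supply coefficients of the right
  -- sign that vanish on `F`.
  have hpos (j : Fin 3) := ((hcont j).isOpen_inter_preimage hop
    isOpen_Ioi (t := Ioi 0)).exists_contMDiff_support_eq (𝓡∂ 3) (n := r)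
  have hneg (j : Fin 3) := ((hcont j).isOpen_inter_preimage hop
    isOpen_Iio (t := Iio 0)).exists_contMDiff_support_eq (𝓡∂ 3) (n := r)
  choose φ hφs hφ hφ0 using hpos
  choose ψ hψs hψ hψ0 using hneg
  have hφi (j : Fin 3) (x : M) : φ j x ≠ 0 ↔ (x ∈ e.baseSet ∧ x ∉ F) ∧ 0 < Λ x (Z j x) := by
    rw [← Function.mem_support, hφs j]
    rfl
  have hψi (j : Fin 3) (x : M) : ψ j x ≠ 0 ↔ (x ∈ e.baseSet ∧ x ∉ F) ∧ Λ x (Z j x) < 0 := by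
    rw [← Function.mem_support, hψs j]
    rfl
  refine ⟨e.baseSet, e.open_baseSet.mem_nhds (FiberBundle.mem_baseSet_trivializationAt' x₀),
    fun x ↦ ∑ j, (φ j x - ψ j x) • Z j x, ?_, fun x hx ↦ ⟨fun hxF ↦ ?_, fun hxF ↦ ?_⟩⟩
  · exact ContMDiffOn.sum_section fun j _ ↦
      ((hφ j).sub (hψ j)).contMDiffOn.smul_section (hZ j)
  · refine Finset.sum_eq_zero fun j _ ↦ ?_
    have h1 : φ j x = 0 := not_not.1 fun h ↦ ((hφi j x).1 h).1.2 hxF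
    have h2 : ψ j x = 0 := not_not.1 fun h ↦ ((hψi j x).1 h).1.2 hxF
    rw [h1, h2, sub_zero, zero_smul]
  · have hsum : Λ x (∑ j, (φ j x - ψ j x) • Z j x : TangentSpace (𝓡∂ 3) x) =
        ∑ j, (φ j x - ψ j x) * Λ x (Z j x) := by
      refine (map_sum (Λ x) _ _).trans (Finset.sum_congr rfl fun j _ ↦ ?_)
      exact map_smul (Λ x) _ _
    have hterm (j : Fin 3) : 0 ≤ (φ j x - ψ j x) * Λ x (Z j x) ∧
        (Λ x (Z j x) ≠ 0 → 0 < (φ j x - ψ j x) * Λ x (Z j x)) := by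
      rcases lt_trichotomy (Λ x (Z j x)) 0 with h | h | h
      · have h1 : φ j x = 0 := not_not.1 fun h' ↦ ((hφi j x).1 h').2.not_gt h
        have h2 : 0 < ψ j x := lt_of_le_of_ne (hψ0 j x) ((hψi j x).2 ⟨⟨hx, hxF⟩, h⟩).symm
        have h3 : 0 < (φ j x - ψ j x) * Λ x (Z j x) := mul_pos_of_neg_of_neg (by linarith) h
        exact ⟨h3.le, fun _ ↦ h3⟩
      · exact ⟨by rw [h, mul_zero], fun h' ↦ (h' h).elim⟩
      · have h1 : ψ j x = 0 := not_not.1 fun h' ↦ ((hψi j x).1 h').2.not_gt h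
        have h2 : 0 < φ j x := lt_of_le_of_ne (hφ0 j x) ((hφi j x).2 ⟨⟨hx, hxF⟩, h⟩).symm
        have h3 : 0 < (φ j x - ψ j x) * Λ x (Z j x) := mul_pos (by linarith) h
        exact ⟨h3.le, fun _ ↦ h3⟩
    obtain ⟨j, hj⟩ : ∃ j, Λ x (Z j x) ≠ 0 := by
      by_contra! hall
      refine hΛ0 x hxF (ContinuousLinearMap.coe_injective ((e.basisAt b hx).ext fun j ↦ ?_))
      rw [← e.localFrame_apply_of_mem_baseSet b hx]
      exact hall j
    rw [hsum]
    exact Finset.sum_pos' (fun j _ ↦ (hterm j).1) ⟨j, Finset.mem_univ j, (hterm j).2 hj⟩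

end LocalFields

/-! ### Local extension of the given field near the boundary -/

section BoundaryFields

open Bundle Topology

variable {M : Type*} [TopologicalSpace M] [ChartedSpace (EuclideanHalfSpace 3) M]
  [IsManifold (𝓡∂ 3) ∞ M]

/-- A section over an embedded submanifold of the tangent bundle of the ambient manifold extends
locally. -/
theorem exists_local_extension_along {m : ℕ} {r : ℕ∞} {S : Type*} [TopologicalSpace S]
    [ChartedSpace (EuclideanSpace ℝ (Fin m)) S] [IsManifold (𝓡 m) ∞ S] {ι : S → M}
    (hι : Manifold.IsSmoothEmbedding (𝓡 m) (𝓡∂ 3) ∞ ι) {v : ∀ s : S, TangentSpace (𝓡 m) s}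
    (hv : ContMDiff (𝓡 m) (𝓡 m).tangent r (fun s ↦ (⟨s, v s⟩ : TangentBundle (𝓡 m) S))) (s₀ : S) :
    ∃ (U : Set M) (Y : ∀ x : M, TangentSpace (𝓡∂ 3) x), IsOpen U ∧ ι s₀ ∈ U ∧
      (∀ x ∈ U, ContMDiffAt (𝓡∂ 3) (𝓡∂ 3).tangent r
        (fun x ↦ (⟨x, Y x⟩ : TangentBundle (𝓡∂ 3) M)) x) ∧
      ∀ s, ι s ∈ U → Y (ι s) = mfderiv (𝓡 m) (𝓡∂ 3) ι s (v s) := by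
  obtain ⟨ret, U, hU, hs₀, hret, hrι⟩ := hι.exists_local_retraction s₀
  let e := trivializationAt (EuclideanSpace ℝ (Fin 3)) (TangentSpace (𝓡∂ 3)) (ι s₀)
  have hs₀e : ι s₀ ∈ e.baseSet := FiberBundle.mem_baseSet_trivializationAt' _
  -- `T x` sits over `ι (ret x)` rather than over `x`; a local trivialization transports it to the
  -- fibre at `x`.
  let T : M → TangentBundle (𝓡∂ 3) M := fun x ↦
    tangentMap (𝓡 m) (𝓡∂ 3) ι (⟨ret x, v (ret x)⟩ : TangentBundle (𝓡 m) S)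
  have hT : ContMDiffOn (𝓡∂ 3) (𝓡∂ 3).tangent r T U := by
    have h1 : ContMDiff (𝓡 m).tangent (𝓡∂ 3).tangent r (tangentMap (𝓡 m) (𝓡∂ 3) ι) :=
      (hι.contMDiff.contMDiff_tangentMap (m := ∞) (by simp)).of_le (by exact_mod_cast le_top)
    exact h1.comp_contMDiffOn (hv.comp_contMDiffOn (hret.of_le (by exact_mod_cast le_top)))
  have hιret : ContinuousOn (fun x ↦ ι (ret x)) U :=
    hι.contMDiff.continuous.comp_continuousOn hret.continuousOn
  refine ⟨(U ∩ (fun x ↦ ι (ret x)) ⁻¹' e.baseSet) ∩ e.baseSet, fun x ↦ e.symm x (e (T x)).2,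
    (hιret.isOpen_inter_preimage hU e.open_baseSet).inter e.open_baseSet,
    ⟨⟨hs₀, ?_⟩, hs₀e⟩, fun x hx ↦ ?_, fun s hs ↦ ?_⟩
  · rwa [mem_preimage, hrι s₀ hs₀]
  · rw [e.contMDiffAt_section_iff hx.2]
    have h1 := ((e.contMDiffAt_iff (n := r) (IB := 𝓡∂ 3) (f := T) (e.mem_source.2 hx.1.2)).1
      (hT.contMDiffAt (hU.mem_nhds hx.1.1))).2
    refine h1.congr_of_eventuallyEq ?_
    filter_upwards [e.open_baseSet.mem_nhds hx.2] with y hy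
    rw [e.apply_mk_symm hy]
  · have h1 : T (ι s) = ⟨ι s, mfderiv (𝓡 m) (𝓡∂ 3) ι s (v s)⟩ := by
      exact congr_arg (fun t ↦ tangentMap (𝓡 m) (𝓡∂ 3) ι (⟨t, v t⟩ : TangentBundle (𝓡 m) S))
        (hrι s hs.1.1)
    simp only [h1]
    exact e.symm_apply_apply_mk hs.2 _

/-- A tangent vector extends to a local smooth vector field. -/
theorem exists_local_extension_vector {r : ℕ∞} (x₀ : M) (w : TangentSpace (𝓡∂ 3) x₀) :
    ∃ (U : Set M) (Y : ∀ x : M, TangentSpace (𝓡∂ 3) x), IsOpen U ∧ x₀ ∈ U ∧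
      (∀ x ∈ U, ContMDiffAt (𝓡∂ 3) (𝓡∂ 3).tangent r
        (fun x ↦ (⟨x, Y x⟩ : TangentBundle (𝓡∂ 3) M)) x) ∧ Y x₀ = w := by
  let e := trivializationAt (EuclideanSpace ℝ (Fin 3)) (TangentSpace (𝓡∂ 3)) x₀
  have hx₀ : x₀ ∈ e.baseSet := FiberBundle.mem_baseSet_trivializationAt' _
  refine ⟨e.baseSet, fun x ↦ e.symm x (e ⟨x₀, w⟩).2, e.open_baseSet, hx₀, fun x hx ↦ ?_,
    e.symm_apply_apply_mk hx₀ w⟩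
  rw [e.contMDiffAt_section_iff hx]
  refine (contMDiffAt_const (c := (e ⟨x₀, w⟩).2)).congr_of_eventuallyEq ?_
  filter_upwards [e.open_baseSet.mem_nhds hx] with y hy
  rw [e.apply_mk_symm hy]

/-- Near the boundary, a tangent vector field of the boundary extends to a vector field which off
the boundary is positive with respect to a given field of covectors that is conormal to the
boundary. -/
theorem exists_local_field_near_boundary {m : ℕ} {r : ℕ∞} {S : Type*} [TopologicalSpace S]
    [ChartedSpace (EuclideanSpace ℝ (Fin m)) S] [IsManifold (𝓡 m) ∞ S] {ι : S → M}
    (hι : Manifold.IsSmoothEmbedding (𝓡 m) (𝓡∂ 3) ∞ ι) (hS : range ι = (𝓡∂ 3).boundary M)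
    {v : ∀ s : S, TangentSpace (𝓡 m) s}
    (hv : ContMDiff (𝓡 m) (𝓡 m).tangent r (fun s ↦ (⟨s, v s⟩ : TangentBundle (𝓡 m) S)))
    {Λ : M → EuclideanSpace ℝ (Fin 3) →L[ℝ] ℝ} {W : Set M} (hW : IsOpen W)
    (hbW : (𝓡∂ 3).boundary M ⊆ W)
    (hΛ : ∀ (n : ℕ∞) (Y : ∀ x : M, TangentSpace (𝓡∂ 3) x), ∀ x₀ ∈ W,
      ContMDiffAt (𝓡∂ 3) (𝓡∂ 3).tangent n (fun x ↦ (⟨x, Y x⟩ : TangentBundle (𝓡∂ 3) M)) x₀ →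
      ContMDiffAt (𝓡∂ 3) 𝓘(ℝ) n (fun x ↦ Λ x (Y x)) x₀)
    (hΛb : ∀ x ∈ (𝓡∂ 3).boundary M, ∃ a > 0, ∀ w, Λ x w = a * w 0) (s₀ : S) :
    ∃ U ∈ 𝓝 (ι s₀), ∃ Y : ∀ x : M, TangentSpace (𝓡∂ 3) x,
      ContMDiffOn (𝓡∂ 3) (𝓡∂ 3).tangent r (fun x ↦ (⟨x, Y x⟩ : TangentBundle (𝓡∂ 3) M)) U ∧
      (∀ s, ι s ∈ U → Y (ι s) = mfderiv (𝓡 m) (𝓡∂ 3) ι s (v s)) ∧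
      ∀ x ∈ U, x ∉ (𝓡∂ 3).boundary M → 0 < Λ x (Y x) := by
  have hb (s : S) : ι s ∈ (𝓡∂ 3).boundary M := hS ▸ mem_range_self s
  obtain ⟨U₁, X, hU₁, hs₁, hX, hXι⟩ := exists_local_extension_along hι hv s₀
  obtain ⟨U₂, N, hU₂, hs₂, hN, hN₀⟩ := exists_local_extension_vector (M := M) (r := r) (ι s₀)
    (EuclideanSpace.single 0 1 : EuclideanSpace ℝ (Fin 3))
  have hNc : ContinuousOn (fun x ↦ Λ x (N x)) (U₂ ∩ W) := fun x hx ↦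
    (hΛ r N x hx.2 (hN x hx.1)).continuousAt.continuousWithinAt
  have hN0 : Λ (ι s₀) (N (ι s₀)) ≠ 0 := by
    obtain ⟨a, a0, ha⟩ := hΛb _ (hb s₀)
    rw [hN₀]
    refine (ha _).trans_ne ?_
    simpa using a0.ne'
  let t : M → ℝ := fun x ↦ extChartAt (𝓡∂ 3) (ι s₀) x 0
  let C := (chartAt (EuclideanHalfSpace 3) (ι s₀)).source
  have ht (x) (hx : x ∈ C) : ContMDiffAt (𝓡∂ 3) 𝓘(ℝ) r t x :=
    ((EuclideanSpace.proj (𝕜 := ℝ) (0 : Fin 3)).contMDiff.contMDiffAt.comp x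
      (contMDiffAt_extChartAt' hx))
  -- Chosen so that `Λ(X + c N) = t`, the normal coordinate, positive off the boundary. On the
  -- boundary both `t` and `Λ(X)` vanish, so `c = 0` and the prescribed values survive.
  let c : M → ℝ := fun x ↦ (t x - Λ x (X x)) / Λ x (N x)
  let Y : ∀ x : M, TangentSpace (𝓡∂ 3) x := fun x ↦ X x + c x • N x
  let U := (U₁ ∩ C) ∩ ((U₂ ∩ W) ∩ (fun x ↦ Λ x (N x)) ⁻¹' {0}ᶜ)
  have hU : IsOpen U := (hU₁.inter (chartAt (EuclideanHalfSpace 3) (ι s₀)).open_source).inter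
    (hNc.isOpen_inter_preimage (hU₂.inter hW) isOpen_compl_singleton)
  have hΛY (x) (hx : x ∈ U) : Λ x (Y x) = t x := by
    have h1 : Λ x (Y x) = Λ x (X x) + c x * Λ x (N x) :=
      (map_add (Λ x) _ _).trans (congr_arg _ (map_smul (Λ x) _ _))
    have h2 : Λ x (N x) ≠ 0 := hx.2.2
    rw [h1, div_mul_cancel₀ _ h2]
    ring
  refine ⟨U, hU.mem_nhds ⟨⟨hs₁, mem_chart_source _ _⟩, ⟨hs₂, hbW (hb s₀)⟩, hN0⟩, Y,
    fun x hx ↦ ?_, fun s hs ↦ ?_, fun x hx hxb ↦ ?_⟩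
  · have h1 := hX x hx.1.1
    have h2 := hN x hx.2.1.1
    have hc : ContMDiffAt (𝓡∂ 3) 𝓘(ℝ) r c x :=
      ((ht x hx.1.2).sub (hΛ r X x hx.2.1.2 h1)).div₀ (hΛ r N x hx.2.1.2 h2) hx.2.2
    exact (h1.add_section (hc.smul_section h2)).contMDiffWithinAt
  · have h1 : Λ (ι s) (X (ι s)) = 0 := by
      obtain ⟨a, -, ha⟩ := hΛb _ (hb s)
      rw [hXι s hs.1.1]
      refine (ha _).trans ?_
      have := mfderiv_apply_zero_of_range_subset_boundary hS.le
        (hι.contMDiff.mdifferentiableAt (x := s) (by simp)) (v s)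
      exact mul_eq_zero_of_right a this
    have h2 : t (ι s) = 0 := (mem_boundary_iff_extChartAt_eq_zero hs.1.2).1 (hb s)
    have h3 : c (ι s) = 0 := by
      simp only [c, h1, h2, sub_zero, zero_div]
    simp only [Y, h3, zero_smul, add_zero, hXι s hs.1.1]
  · rw [hΛY x hx]
    refine (mem_interior_iff_extChartAt_pos hx.1.2).1 ?_
    rwa [← ModelWithCorners.compl_boundary]

end BoundaryFields

/-! ### Gluing and determination of the zeros -/

theorem theorem3p1 (g : ℕ) (r : ℕ∞) (hr : 1 ≤ r)
    -- the solid handlebody `M` with `g` handles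
    {M : Type*} [TopologicalSpace M] [T2Space M] [ChartedSpace (EuclideanHalfSpace 3) M]
    [IsManifold (𝓡∂ 3) ∞ M] (D : SolidHandlebody g M)
    -- its boundary surface `S`, with inclusion `ι`
    {S : Type*} [TopologicalSpace S] [ChartedSpace (EuclideanSpace ℝ (Fin 2)) S]
    [IsManifold (𝓡 2) ∞ S] (ι : S → M)
    (hι : Manifold.IsSmoothEmbedding (𝓡 2) (𝓡∂ 3) ∞ ι)
    (hS : Set.range ι = (𝓡∂ 3).boundary M)
    -- the dynamical system on `S`
    (v : ∀ s : S, TangentSpace (𝓡 2) s) (hv : IsVectorField (𝓡 2) r v) :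
    ∃ V : ∀ x : M, TangentSpace (𝓡∂ 3) x,
      IsVectorField (𝓡∂ 3) r V ∧
      (∀ s : S, V (ι s) = mfderiv (𝓡 2) (𝓡∂ 3) ι s (v s)) ∧
      ∃ p : Fin g → M, (∀ i, p i ∈ D.handleInterior i) ∧
        D.centre ∈ (𝓡∂ 3).interior M ∧ (∀ i, p i ∈ (𝓡∂ 3).interior M) ∧
        {x : M | V x = 0} = ι '' {s : S | v s = 0} ∪ ({D.centre} ∪ Set.range p) := by
  have := D.compactSpace
  obtain ⟨Λ, hΛ, hΛ0, W, hW, hbW, hΛW, hΛb⟩ := D.exists_covectorField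
  let p : Fin g → M := fun i ↦ D.handle i (0, 0)
  have hp (i) : p i ∈ D.handleInterior i := ⟨(0, 0), by simp [openSolidCylinder], rfl⟩
  have hpi (i) : p i ∈ (𝓡∂ 3).interior M := D.handleInterior_subset_interior i (hp i)
  let F : Set M := {D.centre} ∪ range p
  have hFc : IsClosed F := isClosed_singleton.union (finite_range p).isClosed
  have hFi : F ⊆ (𝓡∂ 3).interior M :=
    union_subset (singleton_subset_iff.2 D.centre_mem_interior) (range_subset_iff.2 hpi)
  have hFb (x) (hx : x ∈ F) : x ∉ (𝓡∂ 3).boundary M := by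
    have := hFi hx
    rwa [← ModelWithCorners.compl_boundary] at this
  have hιb (s : S) : ι s ∈ (𝓡∂ 3).boundary M := hS ▸ mem_range_self s
  have hio : IsOpen ((𝓡∂ 3).interior M) := (𝓡∂ 3).isOpen_interior (n := ∞) (by simp)
  let t (x : M) : Set (TangentSpace (𝓡∂ 3) x) := {w |
    (∀ s, ι s = x → w = (mfderiv (𝓡 2) (𝓡∂ 3) ι s (v s) : EuclideanSpace ℝ (Fin 3))) ∧
    (x ∈ F → w = 0) ∧ (x ∉ (𝓡∂ 3).boundary M → x ∉ F → 0 < Λ x w)}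
  have ht (x : M) : Convex ℝ (t x) := by
    rintro a ⟨ha1, ha2, ha3⟩ b ⟨hb1, hb2, hb3⟩ α β hα hβ hαβ
    refine ⟨fun s hs ↦ ?_, fun hx ↦ ?_, fun hx hxF ↦ ?_⟩
    · have h1 := ha1 s hs
      rw [(hb1 s hs).trans h1.symm, ← add_smul, hαβ, one_smul]
      exact h1
    · rw [ha2 hx, hb2 hx, smul_zero, smul_zero, add_zero]
    · have h1 : Λ x (α • a + β • b : TangentSpace (𝓡∂ 3) x) = α * Λ x a + β * Λ x b :=
        (map_add (Λ x) _ _).trans (congr_arg₂ _ (map_smul (Λ x) _ _) (map_smul (Λ x) _ _))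
      have h2 := ha3 hx hxF
      have h3 := hb3 hx hxF
      refine lt_of_lt_of_eq ?_ h1.symm
      -- Weights may vanish, so strict positivity comes from whichever weight is nonzero.
      rcases hα.eq_or_lt with rfl | hα
      · rw [zero_add] at hαβ
        rw [hαβ]
        linarith
      · positivity
  obtain ⟨V, hV⟩ := exists_contMDiffSection_forall_mem_convex_of_local (n := r) (𝓡∂ 3)
    (F_fiber := EuclideanSpace ℝ (Fin 3)) (TangentSpace (𝓡∂ 3)) t ht (fun x₀ ↦ by
      by_cases hx₀ : x₀ ∈ (𝓡∂ 3).boundary M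
      · obtain ⟨s₀, rfl⟩ := hS ▸ hx₀
        obtain ⟨U, hU, Y, hY, hYι, hYΛ⟩ :=
          exists_local_field_near_boundary hι hS hv hW hbW hΛW hΛb s₀
        -- `F` lies in the interior, so near the boundary no vanishing need be imposed.
        refine ⟨U ∩ Fᶜ, Filter.inter_mem hU
          (hFc.isOpen_compl.mem_nhds fun h ↦ hFb _ h hx₀), Y, hY.mono inter_subset_left,
          fun y hy ↦ ⟨?_, fun h ↦ (hy.2 h).elim, fun hyb _ ↦ hYΛ y hy.1 hyb⟩⟩
        rintro s rfl
        exact hYι s hy.1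
      · obtain ⟨U, hU, Y, hY, hYF⟩ := exists_local_positive_field (r := r) hΛ hFc
          (fun x hx ↦ hΛ0 x fun h ↦ hx (Or.inl h)) x₀
        have hx₀i : x₀ ∈ (𝓡∂ 3).interior M := by
          rwa [← ModelWithCorners.compl_boundary]
        refine ⟨U ∩ (𝓡∂ 3).interior M, Filter.inter_mem hU (hio.mem_nhds hx₀i), Y,
          hY.mono inter_subset_left,
          fun y hy ↦ ⟨?_, (hYF y hy.1).1, fun _ ↦ (hYF y hy.1).2⟩⟩
        rintro s rfl
        have := hy.2
        rw [← ModelWithCorners.compl_boundary] at this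
        exact (this (hιb s)).elim)
  refine ⟨fun x ↦ V x, V.contMDiff, fun s ↦ (hV (ι s)).1 s rfl, p, hp, D.centre_mem_interior, hpi,
    ?_⟩
  ext x
  constructor
  · intro (hx : V x = 0)
    by_cases hxF : x ∈ F
    · exact Or.inr hxF
    by_cases hxb : x ∈ (𝓡∂ 3).boundary M
    · obtain ⟨s, rfl⟩ := hS ▸ hxb
      refine Or.inl ⟨s, ?_, rfl⟩
      refine hι.mfderiv_injective s ?_
      rw [map_zero]
      exact ((hV (ι s)).1 s rfl).symm.trans hx
    · have h1 := (hV x).2.2 hxb hxF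
      rw [hx] at h1
      exact absurd (h1.trans_eq (map_zero (Λ x))) (lt_irrefl _)
  · rintro (⟨s, hs, rfl⟩ | hx)
    · change V (ι s) = 0
      refine ((hV (ι s)).1 s rfl).trans ?_
      rw [show v s = 0 from hs]
      exact map_zero (mfderiv (𝓡 2) (𝓡∂ 3) ι s)
    · exact (hV x).2.1 hx
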